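/- Let $F=(F_1,F_2)$ be a holomorphic automorphism of $\mathbb{C}^2$ whose germ at the origin has the form $$F(z,w)=\bigl(z+z^2+O(z^3,z^2w),\; w-zw^2+O(z^4,z^3w,z^2w^2,zw^3)\bigr).$$ For $\epsilon>0$ put $V_\epsilon=\{z\in\mathbb{C}: 0<|z|<\epsilon,\ |\mathrm{Arg}(z)-\pi|<\pi/8\}$, with $\mathrm{Arg}$ valued in $[0,2\pi)$. A function $\gamma:\overline{V_\epsilon}\to\mathbb{C}$ is called a parabolic graph for $F$ over $V_\epsilon$ if it is holomorphic on $V_\epsilon$, continuous on $\overline{V_\epsilon}$, $\gamma(0)=0$, $\gamma(z)/z\to0$ as $z\to 0$ in $V_\epsilon$ (tangency to $(1,0)$), and its graph $\mathcal{C}=\{(z,\gamma(z)):z\in V_\epsilon\}$ satisfies $F(\mathcal{C})\subset\mathcal{C}$ and $F^n(p)\to 0$ as $n\to\infty$ for every $p\in\mathcal{C}$. Such a parabolic graph exists for some $\epsilon>0$. Moreover, for every $\epsilon>0$ and every parabolic graph $\gamma$ for $F$ over $V_\epsilon$, the set $\Gamma=\bigcup_{n\ge0}F^{-n}(\mathcal{C})$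 has the following properties. (i) $F(\Gamma)=\Gamma$. (ii) $\Gamma$ is biholomorphic to $\mathbb{C}$. Here $\Gamma$, the increasing union of the embedded complex curves $F^{-n}(\mathcal{C})$, carries the Riemann surface structure in which every $F^{-n}(\mathcal{C})$ is open and $p\mapsto\pi_1(F^n(p))$ is a chart on it, where $\pi_1(z,w)=z$. More precisely, the map $f(z)=F_1(z,\gamma(z))$ satisfies $f(z)=z+z^2+O(z^3)$ as $z\to0$ in $V_\epsilon$; there is an injective holomorphic function $\zeta:V_\epsilon\to\mathbb{C}$ with $\zeta(f(z))=\zeta(z)+1$ (a Fatou coordinate); and there is a biholomorphic map $\Phi:\Gamma\to\mathbb{C}$ such that $\Phi(p)=\zeta(\pi_1(F^N(p)))-N$ for all $p\in\Gamma$ and all $N\ge0$ with $F^N(p)\in\mathcal{C}$. The inverse $\Phi^{-1}:\mathbb{C}\to\mathbb{C}^2$ is an injective holomorphic immersion with image $\Gamma$. -/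

import Mathlib

/-- An automorphism `F` of `ℂ²` (a holomorphic bijection with holomorphic inverse) with germ
`F(z,w) = (z + z² + O(z³, z²w), w - zw² + O(z⁴, z³w, z²w², zw³))` at the origin.
In particular `F(0) = 0` and `F'(0) = Id`. -/
structure IsSpecialAutomorphism (F : ℂ × ℂ ≃ ℂ × ℂ) : Prop where
  holo : Differentiable ℂ (fun p => F p)
  holo_symm : Differentiable ℂ (fun p => F.symm p)
  germ_fst : (fun p : ℂ × ℂ => (F p).1 - (p.1 + p.1 ^ 2))
    =O[nhds 0] (fun p : ℂ × ℂ => ‖p.1‖ ^ 3 + ‖p.1‖ ^ 2 * ‖p.2‖)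
  germ_snd : (fun p : ℂ × ℂ => (F p).2 - (p.2 - p.1 * p.2 ^ 2))
    =O[nhds 0] (fun p : ℂ × ℂ =>
      ‖p.1‖ ^ 4 + ‖p.1‖ ^ 3 * ‖p.2‖ + ‖p.1‖ ^ 2 * ‖p.2‖ ^ 2 + ‖p.1‖ * ‖p.2‖ ^ 3)

/-- The sector `V_ε = {z : 0 < |z| < ε, |Arg z - π| < π/8}`, with `Arg` valued in `[0, 2π)`.
Since `Complex.arg` is valued in `(-π, π]`, the number `Arg z - π` is `Complex.arg (-z)`
on this sector. -/
def sector (ε : ℝ) : Set ℂ :=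
  {z | 0 < ‖z‖ ∧ ‖z‖ < ε ∧ |Complex.arg (-z)| < Real.pi / 8}

/-- The graph `C = {(z, γ(z)) : z ∈ V_ε}`. -/
def graphCurve (ε : ℝ) (γ : ℂ → ℂ) : Set (ℂ × ℂ) :=
  (fun z => (z, γ z)) '' sector ε

/-- `z ↦ (z, γ(z))` on `V_ε` is a parabolic curve for `F` at the origin, tangent to the
direction `(1,0)`: it is holomorphic on `V_ε`, continuous up to the closure with value `0` at
the origin, tangent to `[1 : 0]` there, its image is invariant under `F`, and all points of the
image are attracted to the origin. -/
structure IsParabolicGraph (F : ℂ × ℂ → ℂ × ℂ) (ε : ℝ) (γ : ℂ → ℂ) : Prop where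
  holo : DifferentiableOn ℂ γ (sector ε)
  cont : ContinuousOn γ (closure (sector ε))
  map_zero : γ 0 = 0
  tangent : Filter.Tendsto (fun z => γ z / z) (nhdsWithin 0 (sector ε)) (nhds 0)
  invariant : Set.MapsTo F (graphCurve ε γ) (graphCurve ε γ)
  attracted : ∀ p ∈ graphCurve ε γ,
    Filter.Tendsto (fun n : ℕ => F^[n] p) Filter.atTop (nhds 0)

/-- `Γ = ⋃_{n ≥ 0} F⁻ⁿ(C)`. -/
def globalCurve (F : ℂ × ℂ → ℂ × ℂ) (ε : ℝ) (γ : ℂ → ℂ) : Set (ℂ × ℂ) :=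
  ⋃ n : ℕ, F^[n] ⁻¹' graphCurve ε γ

/-- The action `z ↦ π₁(F(z, γ(z)))` of `F` on the curve, read in the coordinate `z`. -/
def curveMap (F : ℂ × ℂ → ℂ × ℂ) (γ : ℂ → ℂ) (z : ℂ) : ℂ := (F (z, γ z)).1

/-- `ζ` is a Fatou coordinate for `f` on `V`: an injective holomorphic function on `V`
conjugating `f` to the translation by `1`. -/
structure IsFatouCoordinate (f : ℂ → ℂ) (V : Set ℂ) (ζ : ℂ → ℂ) : Prop where
  holo : DifferentiableOn ℂ ζ V
  inj : Set.InjOn ζ V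
  abel : ∀ z ∈ V, ζ (f z) = ζ z + 1

/-- The parametrization `σ_n(z) = F⁻ⁿ(z, γ(z))`, `z ∈ V_ε`, of the piece `F⁻ⁿ(C)` of `Γ`.
Its inverse on `F⁻ⁿ(C)` is `p ↦ π₁(Fⁿ(p))`. -/
def pieceParam (F : ℂ × ℂ ≃ ℂ × ℂ) (γ : ℂ → ℂ) (n : ℕ) (z : ℂ) : ℂ × ℂ :=
  F.symm^[n] (z, γ z)

/-- `Φ` restricts to a biholomorphic map from `Γ` onto `ℂ`, with inverse `ψ`.
Here `Γ` is the increasing union of the embedded complex curves `F⁻ⁿ(C)`, and carries the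
resulting structure of a Riemann surface, injectively immersed in `ℂ²`: the pieces `F⁻ⁿ(C)` are
open in `Γ` and the maps `p ↦ π₁(Fⁿ(p))` on them, with inverses `pieceParam F γ n`, are its
charts. (The topology of `Γ` may be finer than the one induced from `ℂ²`.)
The fields say that `Φ` and `ψ` are mutually inverse bijections between `Γ` and `ℂ`, that both
are holomorphic in the charts, and that `ψ` is a holomorphic immersion into `ℂ²`. -/
structure IsBiholomorphismOntoPlane (F : ℂ × ℂ ≃ ℂ × ℂ) (ε : ℝ) (γ : ℂ → ℂ)
    (Φ : ℂ × ℂ → ℂ) (ψ : ℂ → ℂ × ℂ) : Prop where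
  mem : ∀ t, ψ t ∈ globalCurve F ε γ
  right_inv : ∀ t, Φ (ψ t) = t
  left_inv : ∀ p ∈ globalCurve F ε γ, ψ (Φ p) = p
  holo_chart : ∀ n : ℕ, DifferentiableOn ℂ (fun z => Φ (pieceParam F γ n z)) (sector ε)
  isOpen_piece : ∀ n : ℕ, IsOpen (ψ ⁻¹' (F^[n] ⁻¹' graphCurve ε γ))
  holo_symm_chart : ∀ n : ℕ, DifferentiableOn ℂ (fun t => (F^[n] (ψ t)).1)
    (ψ ⁻¹' (F^[n] ⁻¹' graphCurve ε γ))
  holo_symm : Differentiable ℂ ψ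
  immersion : ∀ t, deriv ψ t ≠ 0

/-!
Everything happens in the coordinate `Z = -1/z`, in which the sector becomes a truncated cone about
the positive real axis and `z ↦ z + z² + …` becomes a small perturbation of `Z ↦ Z + 1`.

**Existence of a parabolic graph.** In the coordinates `(Z, w)` the map `F` reads
`(Z + 1 + A(Z, w), w - G(Z, w))`. An orbit with `wₙ → 0` satisfies `wₙ = ∑_{k ≥ n} G(Z_k, w_k)`, and
conversely. For a given `Z₀` with `Re Z₀ ≥ R` this is a fixed point problem for the sequences of
increments `Zₙ₊₁ - Zₙ - 1` and of the normalized heights `(R + n/2)² wₙ`. The germ conditions and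
Cauchy's estimates (`exists_isPerronPair`) make the corresponding operator a contraction in the
supremum norm once `R` is large (`IsPerronPair.norm_perronOp_sub_le`). The Picard iterates are
holomorphic in `Z₀` and converge uniformly, so `w₀` is a holomorphic function of `Z₀`; its graph is
invariant because the shift of a stable orbit is a stable orbit and these are unique
(`IsPerronPair.stableGraph_invariant`). Uniqueness also makes the bounds for larger `R` available,
which gives `w₀ = O(Z₀⁻²)`, hence tangency and continuity at the origin.

**Uniformization of the global curve.** On any parabolic graph the first component of `F` reads
`g(Z) = Z + 1 + O(1/Z)`. By Cauchy's estimate the error term has Lipschitz constant `O(x⁻²)` on the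
cone where `Re Z > x`, so `gⁿ(Z) - gⁿ(W)` converges, with total drift at most `|Z - W|/20` on a cone
far out (`IsNearTranslation.norm_fatou_sub_le`). The limit with `W` fixed is a Fatou coordinate. Being
close to a translation, it is injective, has a holomorphic inverse, and its image meets
`t + ℕ` for every `t`. Every orbit on the curve enters the cone, because the increments of `Z` along
it tend to `1`. Hence the Fatou coordinate extends to the global curve by `ζ(Fᴺ p) - N`, and the
extension is a bijection onto `ℂ` that is biholomorphic in the charts
(`exists_isBiholomorphismOntoPlane`).
-/

/-! ### Elementary estimates -/

/-- The weights `R + k/2` bound from below the real parts of orbits of maps close to `Z ↦ Z + 1`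
in the coordinate `Z = -1/z`. -/
theorem sum_inv_sq_le {R : ℝ} (hR : 1 ≤ R) (n : ℕ) :
    ∑ k ∈ Finset.range n, 1 / (R + k / 2) ^ 2 ≤ 4 / R := by
  have key : ∑ k ∈ Finset.range n, 1 / (R + k / 2) ^ 2
      ≤ 2 / (R - 1 / 2) - 2 / (R + n / 2 - 1 / 2) := by
    induction n with
    | zero => simp
    | succ n ih =>
      rw [Finset.sum_range_succ]
      set q : ℝ := R + n / 2 with hq
      have hq1 : 1 ≤ q := by
        have : (0 : ℝ) ≤ n := n.cast_nonneg
        rw [hq]; linarith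
      have e : R + ((n + 1 : ℕ) : ℝ) / 2 - 1 / 2 = q := by push_cast; rw [hq]; ring
      rw [e]
      have h1 : 1 / q ^ 2 ≤ 2 / (q - 1 / 2) - 2 / q := by
        have : 0 < q - 1 / 2 := by linarith
        rw [div_sub_div _ _ this.ne' (by positivity), div_le_div_iff₀ (by positivity) (by positivity)]
        nlinarith
      linarith
  have h2 : 0 ≤ 2 / (R + n / 2 - 1 / 2) := by
    have : (0 : ℝ) ≤ n := n.cast_nonneg
    apply div_nonneg <;> linarith
  have h3 : 2 / (R - 1 / 2) ≤ 4 / R := by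
    rw [div_le_div_iff₀ (by linarith) (by linarith)]; linarith
  linarith

theorem summable_inv_sq {R : ℝ} (hR : 1 ≤ R) :
    Summable fun k : ℕ => 1 / (R + k / 2) ^ 2 :=
  summable_of_sum_range_le (fun _ => by positivity) (sum_inv_sq_le hR)

theorem tsum_inv_sq_le {R : ℝ} (hR : 1 ≤ R) :
    ∑' k : ℕ, 1 / (R + k / 2) ^ 2 ≤ 4 / R :=
  Real.tsum_le_of_sum_range_le (fun _ => by positivity) (sum_inv_sq_le hR)

/-- A bounded holomorphic function is Lipschitz on a convex set that stays away from the boundary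
of its domain, by Cauchy's estimate for the derivative. -/
theorem norm_sub_le_of_differentiableOn {f : ℂ → ℂ} {U S : Set ℂ} {M r : ℝ} (hr : 0 < r)
    (hf : ∀ z ∈ U, DifferentiableAt ℂ f z) (hM : ∀ z ∈ U, ‖f z‖ ≤ M) (hS : Convex ℝ S)
    (hSU : ∀ z ∈ S, Metric.closedBall z r ⊆ U) {x y : ℂ} (hx : x ∈ S) (hy : y ∈ S) :
    ‖f x - f y‖ ≤ M / r * ‖x - y‖ := by
  refine Convex.norm_image_sub_le_of_norm_deriv_le (𝕜 := ℂ) (s := S) ?_ ?_ hS hy hx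
  · exact fun z hz => hf z (hSU z hz (Metric.mem_closedBall_self hr.le))
  · intro z hz
    refine Complex.norm_deriv_le_of_forall_mem_sphere_norm_le hr ?_
      (fun w hw => hM w (hSU z hz (Metric.sphere_subset_closedBall hw)))
    apply DifferentiableOn.diffContOnCl
    rw [closure_ball _ hr.ne']
    exact fun w hw => (hf w (hSU z hz hw)).differentiableWithinAt

/-- A germ `f = z + z² + O(c z²)` reads `Z ↦ Z + 1 + O(c + z)` in the coordinate `Z = -1/z`. -/
theorem neg_inv_add_inv_sub_one {z f : ℂ} {c : ℝ} (hz : z ≠ 0) (hz4 : ‖z‖ ≤ 1 / 4)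
    (hc : c ≤ 1) (hf : ‖f - (z + z ^ 2)‖ ≤ c * ‖z‖ ^ 2) :
    f ≠ 0 ∧ ‖-f⁻¹ - (-z⁻¹) - 1‖ ≤ 4 * (c + ‖z‖) := by
  have hz0 : 0 < ‖z‖ := norm_pos_iff.2 hz
  set e := f - (z + z ^ 2) with he
  have hfe : f = z + z ^ 2 + e := by rw [he]; ring
  have hflow : ‖z‖ / 2 ≤ ‖f‖ := by
    have h1 : ‖z‖ ≤ ‖f‖ + ‖z ^ 2‖ + ‖e‖ := by
      calc ‖z‖ = ‖f - z ^ 2 - e‖ := by rw [hfe]; congr 1; ring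
        _ ≤ _ := (norm_sub_le _ _).trans (by gcongr; exact norm_sub_le _ _)
    rw [norm_pow] at h1
    nlinarith [mul_le_mul_of_nonneg_right hc (sq_nonneg ‖z‖)]
  have hf0 : f ≠ 0 := by rw [← norm_pos_iff]; linarith
  refine ⟨hf0, ?_⟩
  have hc0 : 0 ≤ c := by
    by_contra h
    have : c * ‖z‖ ^ 2 < 0 := mul_neg_of_neg_of_pos (not_le.1 h) (by positivity)
    linarith [norm_nonneg e]
  have e1 : -f⁻¹ - (-z⁻¹) - 1 = (e - z ^ 3 - z * e) / (z * f) := by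
    field_simp
    rw [hfe]; ring
  rw [e1, norm_div, norm_mul, div_le_iff₀ (by positivity)]
  have h2 : ‖e - z ^ 3 - z * e‖ ≤ c * ‖z‖ ^ 2 + ‖z‖ ^ 3 + ‖z‖ * (c * ‖z‖ ^ 2) := by
    refine (norm_sub_le _ _).trans (add_le_add ((norm_sub_le _ _).trans ?_) ?_)
    · rw [norm_pow]; gcongr
    · rw [norm_mul]; gcongr
  refine h2.trans ?_
  have h3 : 4 * (c + ‖z‖) * (‖z‖ * (‖z‖ / 2)) ≤ 4 * (c + ‖z‖) * (‖z‖ * ‖f‖) := by gcongr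
  have h4 : ‖z‖ * (c * ‖z‖ ^ 2) ≤ 1 / 4 * (c * ‖z‖ ^ 2) := by gcongr
  nlinarith [mul_nonneg hc0 (sq_nonneg ‖z‖), pow_nonneg hz0.le 3]

/-! ### The sector -/

theorem cos_pi_div_eight_bounds :
    0.92 < Real.cos (Real.pi / 8) ∧ Real.cos (Real.pi / 8) < 0.924 := by
  rw [Real.cos_pi_div_eight]
  have h1 : (1.414 : ℝ) < √2 := Real.lt_sqrt_of_sq_lt (by norm_num)
  have h2 : √2 < (1.4143 : ℝ) := by rw [Real.sqrt_lt' (by norm_num)]; norm_num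
  have h3 : (1.84 : ℝ) < √(2 + √2) := Real.lt_sqrt_of_sq_lt (by norm_num at *; linarith)
  have h4 : √(2 + √2) < (1.848 : ℝ) := by
    rw [Real.sqrt_lt' (by norm_num)]; norm_num at *; linarith
  constructor <;> norm_num at * <;> linarith

theorem mem_sector_iff {ε : ℝ} {z : ℂ} :
    z ∈ sector ε ↔ 0 < ‖z‖ ∧ ‖z‖ < ε ∧ Real.cos (Real.pi / 8) * ‖z‖ < -z.re := by
  unfold sector
  simp only [Set.mem_ofPred_eq]
  refine and_congr_right fun hz => and_congr_right fun _ => ?_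
  have hz' : -z ≠ 0 := neg_ne_zero.2 (norm_pos_iff.1 hz)
  have h1 := Complex.cos_arg hz'
  rw [← Real.cos_abs, norm_neg, Complex.neg_re] at h1
  rw [← lt_div_iff₀ hz, ← h1]
  refine (Real.strictAntiOn_cos.lt_iff_gt ?_ ?_).symm
  · constructor <;> linarith [Real.pi_pos]
  · exact ⟨abs_nonneg _, Complex.abs_arg_le_pi _⟩

theorem neg_inv_mem_sector_iff {ε : ℝ} (hε : 0 < ε) {Z : ℂ} :
    -Z⁻¹ ∈ sector ε ↔ 0 < ‖Z‖ ∧ 1 / ε < ‖Z‖ ∧ Real.cos (Real.pi / 8) * ‖Z‖ < Z.re := by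
  rw [mem_sector_iff, norm_neg, norm_inv, inv_pos]
  refine and_congr_right fun hZ => and_congr ?_ ?_
  · rw [one_div, inv_lt_comm₀ hZ hε]
  · rw [Complex.neg_re, neg_neg, Complex.inv_re, Complex.normSq_eq_norm_sq,
      lt_div_iff₀ (by positivity)]
    have : Real.cos (Real.pi / 8) * ‖Z‖⁻¹ * ‖Z‖ ^ 2 = Real.cos (Real.pi / 8) * ‖Z‖ := by
      field_simp
    rw [this]

theorem isOpen_sector (ε : ℝ) : IsOpen (sector ε) := by
  have : sector ε = {z : ℂ | 0 < ‖z‖} ∩ ({z : ℂ | ‖z‖ < ε} ∩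
      {z : ℂ | Real.cos (Real.pi / 8) * ‖z‖ < -z.re}) := by
    ext z; exact mem_sector_iff
  rw [this]
  refine (isOpen_lt ?_ ?_).inter ((isOpen_lt ?_ ?_).inter (isOpen_lt ?_ ?_)) <;> fun_prop

/-! ### Cones about the positive real axis -/

/-- The truncated cone `{Re Z > R, |Im Z| < c Re Z}`. -/
def cone (c R : ℝ) : Set ℂ := {Z | R < Z.re ∧ |Z.im| < c * Z.re}

theorem isOpen_cone (c R : ℝ) : IsOpen (cone c R) := by
  have h1 : IsOpen {Z : ℂ | R < Z.re} := isOpen_lt (by fun_prop) (by fun_prop)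
  have h2 : IsOpen {Z : ℂ | |Z.im| < c * Z.re} := isOpen_lt (by fun_prop) (by fun_prop)
  exact h1.inter h2

theorem convex_cone (c R : ℝ) : Convex ℝ (cone c R) := by
  intro x hx y hy a b ha hb hab
  obtain ⟨hx1, hx2⟩ := hx
  obtain ⟨hy1, hy2⟩ := hy
  rw [abs_lt] at hx2 hy2
  simp only [cone, Set.mem_ofPred_eq, Complex.add_re, Complex.real_smul, Complex.mul_re,
    Complex.ofReal_re, Complex.ofReal_im, zero_mul, sub_zero, Complex.add_im, Complex.mul_im,
    add_zero, abs_lt]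
  rcases ha.eq_or_lt with rfl | ha
  · obtain rfl : b = 1 := by linarith
    simp; exact ⟨hy1, hy2⟩
  · refine ⟨?_, ?_, ?_⟩
    · have : R = a * R + b * R := by rw [← add_mul, hab, one_mul]
      nlinarith [mul_lt_mul_of_pos_left hx1 ha, mul_le_mul_of_nonneg_left hy1.le hb]
    · nlinarith [mul_lt_mul_of_pos_left hx2.1 ha, mul_le_mul_of_nonneg_left hy2.1.le hb]
    · nlinarith [mul_lt_mul_of_pos_left hx2.2 ha, mul_le_mul_of_nonneg_left hy2.2.le hb]

theorem norm_le_of_mem_cone {R : ℝ} (hR : 0 ≤ R) {Z : ℂ} (hZ : Z ∈ cone (2 / 5) R) :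
    Real.cos (Real.pi / 8) * ‖Z‖ < Z.re := by
  obtain ⟨h1, h2⟩ := hZ
  have h0 : 0 < Z.re := by linarith
  have hc := cos_pi_div_eight_bounds
  have hn : ‖Z‖ ^ 2 = Z.re ^ 2 + Z.im ^ 2 := by
    rw [← Complex.normSq_eq_norm_sq, Complex.normSq_apply]; ring
  have him : Z.im ^ 2 < (2 / 5 * Z.re) ^ 2 := by
    rw [← sq_abs Z.im]; exact pow_lt_pow_left₀ h2 (abs_nonneg _) (by norm_num)
  have : ‖Z‖ < 1.0775 * Z.re := by
    refine lt_of_pow_lt_pow_left₀ 2 (by positivity) ?_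
    rw [hn]; nlinarith
  norm_num at *
  nlinarith [norm_nonneg Z]

theorem neg_inv_mem_sector_of_mem_cone {ε : ℝ} (hε : 0 < ε) {Z : ℂ}
    (hZ : Z ∈ cone (2 / 5) (1 / ε)) : -Z⁻¹ ∈ sector ε := by
  have h1 : 0 < 1 / ε := by positivity
  have h2 : Z.re ≤ ‖Z‖ := Complex.re_le_norm Z
  exact (neg_inv_mem_sector_iff hε).2
    ⟨by linarith [hZ.1], by linarith [hZ.1], norm_le_of_mem_cone h1.le hZ⟩

/-- A sequence whose increments tend to `1` eventually enters every cone. -/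
theorem eventually_mem_cone {u : ℕ → ℂ}
    (hu : Filter.Tendsto (fun n => u (n + 1) - u n) Filter.atTop (nhds 1)) {c : ℝ} (hc : 0 < c)
    (R : ℝ) : ∀ᶠ n in Filter.atTop, u n ∈ cone c R := by
  have h1 := hu.cesaro_smul
  have h2 : Filter.Tendsto (fun n : ℕ => (n : ℝ)⁻¹ • u n) Filter.atTop (nhds 1) := by
    have h3 : Filter.Tendsto (fun n : ℕ => (n : ℝ)⁻¹ • u 0) Filter.atTop (nhds ((0 : ℝ) • u 0)) :=
      (tendsto_inv_atTop_zero.comp tendsto_natCast_atTop_atTop).smul_const _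
    have := h1.add h3
    rw [zero_smul, add_zero] at this
    refine this.congr fun n => ?_
    rw [Finset.sum_range_sub, ← smul_add, sub_add_cancel]
  have hre := (Complex.continuous_re.tendsto _).comp h2
  have him := ((Complex.continuous_im.tendsto _).comp h2).abs
  simp only [Complex.one_re, Complex.one_im, abs_zero] at hre him
  filter_upwards [hre.eventually (lt_mem_nhds (show (1 / 2 : ℝ) < 1 by norm_num)),
    him.eventually (gt_mem_nhds (show (0 : ℝ) < c / 2 by linarith)),
    Filter.eventually_gt_atTop 0, Filter.eventually_ge_atTop ⌈2 * R⌉₊] with n hn1 hn2 hn0 hnR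
  have hn : (0 : ℝ) < n := by exact_mod_cast hn0
  simp only [Function.comp, Complex.real_smul, Complex.mul_re, Complex.mul_im, Complex.ofReal_re,
    Complex.ofReal_im, zero_mul, sub_zero, add_zero, abs_mul,
    abs_of_pos (inv_pos.2 hn)] at hn1 hn2
  rw [inv_mul_eq_div, lt_div_iff₀ hn] at hn1
  rw [inv_mul_eq_div, div_lt_iff₀ hn] at hn2
  have hR := Nat.ceil_le.1 hnR
  exact ⟨by linarith, by nlinarith⟩

/-! ### Fatou coordinates near infinity -/

/-- `g` is holomorphic on the cone `{Re Z > R/2, |Im Z| < 2/5 Re Z}` and differs there from the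
translation by `1` by at most `C / Re Z`. The factor `6400` is what brings the total drift
`320 C / R` of two orbits below `1/20`. -/
structure IsNearTranslation (g : ℂ → ℂ) (C R : ℝ) : Prop where
  one_le : 1 ≤ R
  nonneg : 0 ≤ C
  le : 6400 * C ≤ R
  diff : ∀ Z ∈ cone (2 / 5) (R / 2), DifferentiableAt ℂ g Z
  bound : ∀ Z ∈ cone (2 / 5) (R / 2), ‖g Z - Z - 1‖ ≤ C / Z.re

namespace IsNearTranslation

variable {g : ℂ → ℂ} {C R : ℝ}

theorem closedBall_subset {x : ℝ} (hx : 0 < x) {Z : ℂ} (hZ : Z ∈ cone (3 / 10) x) :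
    Metric.closedBall Z (x / 20) ⊆ cone (2 / 5) (x / 2) := by
  intro W hW
  rw [mem_closedBall_iff_norm] at hW
  have h1 := abs_le.1 ((Complex.abs_re_le_norm (W - Z)).trans hW)
  have h2 := abs_le.1 ((Complex.abs_im_le_norm (W - Z)).trans hW)
  obtain ⟨h3, h4⟩ := hZ
  rw [abs_lt] at h4
  rw [Complex.sub_re] at h1
  rw [Complex.sub_im] at h2
  refine ⟨by linarith, abs_lt.2 ⟨by linarith, by linarith⟩⟩

theorem cone_subset {c x : ℝ} (hx : R ≤ x) : cone c (x / 2) ⊆ cone c (R / 2) :=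
  fun _ hZ => ⟨by linarith [hZ.1], hZ.2⟩

theorem cone_subset_cone {x : ℝ} (hx : 0 < x) : cone (3 / 10) x ⊆ cone (2 / 5) (x / 2) :=
  fun _ hZ => closedBall_subset hx hZ (Metric.mem_closedBall_self (by positivity))

theorem lipschitz (hg : IsNearTranslation g C R) {x : ℝ} (hx : R ≤ x) {Z W : ℂ}
    (hZ : Z ∈ cone (3 / 10) x) (hW : W ∈ cone (3 / 10) x) :
    ‖(g Z - Z - 1) - (g W - W - 1)‖ ≤ 40 * C * (1 / x ^ 2) * ‖Z - W‖ := by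
  have hx0 : 0 < x := by linarith [hg.one_le]
  have := norm_sub_le_of_differentiableOn (f := fun Z => g Z - Z - 1) (U := cone (2 / 5) (x / 2))
    (S := cone (3 / 10) x) (M := C / (x / 2)) (r := x / 20) (by positivity) ?_ ?_
    (convex_cone _ _) (fun z hz => closedBall_subset hx0 hz) hZ hW
  · refine this.trans (le_of_eq ?_)
    field_simp; ring
  · intro z hz
    exact ((hg.diff z (cone_subset hx hz)).sub differentiableAt_id).sub_const 1
  · intro z hz
    refine (hg.bound z (cone_subset hx hz)).trans ?_
    have := hg.nonneg
    gcongr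
    exact hz.1.le

theorem mapsTo (hg : IsNearTranslation g C R) {x : ℝ} (hx : R ≤ x) {Z : ℂ}
    (hZ : Z ∈ cone (3 / 10) x) : g Z ∈ cone (3 / 10) (x + 1 / 2) := by
  have hR := hg.one_le
  have hb := hg.bound Z (cone_subset hx (cone_subset_cone (by linarith) hZ))
  obtain ⟨h3, h4⟩ := hZ
  have hb' : ‖g Z - Z - 1‖ ≤ 1 / 20 := by
    refine hb.trans ?_
    rw [div_le_iff₀ (by linarith)]
    linarith [hg.le, hg.nonneg]
  have h1 := abs_le.1 ((Complex.abs_re_le_norm _).trans hb')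
  have h2 := abs_le.1 ((Complex.abs_im_le_norm _).trans hb')
  simp only [Complex.sub_re, Complex.sub_im, Complex.one_re, Complex.one_im] at h1 h2
  rw [abs_lt] at h4
  exact ⟨by linarith, abs_lt.2 ⟨by linarith, by linarith⟩⟩

theorem iterate_mem (hg : IsNearTranslation g C R) {Z : ℂ} (hZ : Z ∈ cone (3 / 10) R) (n : ℕ) :
    g^[n] Z ∈ cone (3 / 10) (R + n / 2) := by
  induction n with
  | zero => simpa using hZ
  | succ n ih =>
    rw [Function.iterate_succ_apply']
    have hn : (0 : ℝ) ≤ n := n.cast_nonneg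
    have := hg.mapsTo (by linarith) ih
    convert this using 2
    push_cast; ring

/-- The `n`-th term of the series whose sum measures how the orbits of `Z` and `W` drift apart. -/
def drift (g : ℂ → ℂ) (Z W : ℂ) (n : ℕ) : ℂ :=
  (g (g^[n] Z) - g^[n] Z - 1) - (g (g^[n] W) - g^[n] W - 1)

theorem sum_drift (g : ℂ → ℂ) (Z W : ℂ) (n : ℕ) :
    ∑ k ∈ Finset.range n, drift g Z W k = (g^[n] Z - g^[n] W) - (Z - W) := by
  have : ∀ k, drift g Z W k = (g^[k + 1] Z - g^[k + 1] W) - (g^[k] Z - g^[k] W) := by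
    intro k
    rw [drift, Function.iterate_succ_apply', Function.iterate_succ_apply']; ring
  simp_rw [this]
  rw [Finset.sum_range_sub (fun k => g^[k] Z - g^[k] W)]
  rfl

theorem norm_drift_le_aux (hg : IsNearTranslation g C R) {Z W : ℂ} (hZ : Z ∈ cone (3 / 10) R)
    (hW : W ∈ cone (3 / 10) R) (n : ℕ) :
    ‖drift g Z W n‖ ≤ 40 * C * (1 / (R + n / 2) ^ 2) * ‖g^[n] Z - g^[n] W‖ := by
  have hn : (0 : ℝ) ≤ n := n.cast_nonneg
  exact hg.lipschitz (by linarith) (hg.iterate_mem hZ n) (hg.iterate_mem hW n)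

/-- Two orbits stay within twice their initial distance: as long as they do, the drift
accumulated is at most `320 C / R` times that distance. -/
theorem norm_iterate_sub_le (hg : IsNearTranslation g C R) {Z W : ℂ} (hZ : Z ∈ cone (3 / 10) R)
    (hW : W ∈ cone (3 / 10) R) (n : ℕ) : ‖g^[n] Z - g^[n] W‖ ≤ 2 * ‖Z - W‖ := by
  induction n using Nat.strong_induction_on with
  | _ n ih =>
    have h0 := hg.nonneg
    have hR := hg.one_le
    have h1 : ‖∑ k ∈ Finset.range n, drift g Z W k‖ ≤ ‖Z - W‖ := by
      calc ‖∑ k ∈ Finset.range n, drift g Z W k‖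
          ≤ ∑ k ∈ Finset.range n, (80 * C * ‖Z - W‖) * (1 / (R + k / 2) ^ 2) := by
            refine norm_sum_le_of_le _ fun k hk => (hg.norm_drift_le_aux hZ hW k).trans ?_
            calc _ ≤ 40 * C * (1 / (R + k / 2) ^ 2) * (2 * ‖Z - W‖) := by
                  gcongr; exact ih k (Finset.mem_range.1 hk)
              _ = _ := by ring
        _ ≤ (80 * C * ‖Z - W‖) * (4 / R) := by
            rw [← Finset.mul_sum]
            gcongr
            exact sum_inv_sq_le hR n
        _ = (320 * C / R) * ‖Z - W‖ := by ring
        _ ≤ 1 * ‖Z - W‖ := by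
            gcongr
            rw [div_le_one (by linarith)]; linarith [hg.le]
        _ = ‖Z - W‖ := one_mul _
    calc ‖g^[n] Z - g^[n] W‖ = ‖∑ k ∈ Finset.range n, drift g Z W k + (Z - W)‖ := by
          rw [sum_drift]; congr 1; ring
      _ ≤ ‖Z - W‖ + ‖Z - W‖ := (norm_add_le _ _).trans (by gcongr)
      _ = _ := by ring

theorem norm_drift_le (hg : IsNearTranslation g C R) {Z W : ℂ} (hZ : Z ∈ cone (3 / 10) R)
    (hW : W ∈ cone (3 / 10) R) (n : ℕ) :
    ‖drift g Z W n‖ ≤ 80 * C * ‖Z - W‖ * (1 / (R + n / 2) ^ 2) := by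
  have h0 := hg.nonneg
  calc _ ≤ 40 * C * (1 / (R + n / 2) ^ 2) * (2 * ‖Z - W‖) := by
        refine (hg.norm_drift_le_aux hZ hW n).trans ?_
        gcongr; exact hg.norm_iterate_sub_le hZ hW n
    _ = _ := by ring

theorem summable_drift (hg : IsNearTranslation g C R) {Z W : ℂ} (hZ : Z ∈ cone (3 / 10) R)
    (hW : W ∈ cone (3 / 10) R) : Summable (drift g Z W) :=
  .of_norm_bounded ((summable_inv_sq hg.one_le).mul_left _) (hg.norm_drift_le hZ hW)

theorem norm_tsum_drift_le (hg : IsNearTranslation g C R) {Z W : ℂ} (hZ : Z ∈ cone (3 / 10) R)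
    (hW : W ∈ cone (3 / 10) R) : ‖∑' n, drift g Z W n‖ ≤ 1 / 20 * ‖Z - W‖ := by
  have h0 := hg.nonneg
  have hR := hg.one_le
  calc ‖∑' n, drift g Z W n‖ ≤ ∑' n : ℕ, 80 * C * ‖Z - W‖ * (1 / (R + n / 2) ^ 2) :=
        tsum_of_norm_bounded ((summable_inv_sq hR).mul_left _).hasSum (hg.norm_drift_le hZ hW)
    _ ≤ (80 * C * ‖Z - W‖) * (4 / R) := by
        rw [tsum_mul_left]
        gcongr
        exact tsum_inv_sq_le hR
    _ = (320 * C / R) * ‖Z - W‖ := by ring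
    _ ≤ _ := by
        refine mul_le_mul_of_nonneg_right ?_ (norm_nonneg _)
        rw [div_le_div_iff₀ (by linarith) (by norm_num)]; linarith [hg.le]

/-- The Fatou coordinate `ζ(Z) = lim (gⁿ(Z) - gⁿ(R + 1))`, written as a series. -/
noncomputable def fatou (g : ℂ → ℂ) (R : ℝ) (Z : ℂ) : ℂ :=
  Z - (R + 1 : ℝ) + ∑' n, drift g Z (R + 1 : ℝ) n

theorem base_mem (hg : IsNearTranslation g C R) : ((R + 1 : ℝ) : ℂ) ∈ cone (3 / 10) R := by
  have := hg.one_le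
  refine ⟨by rw [Complex.ofReal_re]; linarith, ?_⟩
  rw [Complex.ofReal_im, Complex.ofReal_re, abs_zero]; linarith

theorem tendsto_fatou (hg : IsNearTranslation g C R) {Z : ℂ} (hZ : Z ∈ cone (3 / 10) R) :
    Filter.Tendsto (fun n => g^[n] Z - g^[n] (R + 1 : ℝ)) Filter.atTop (nhds (fatou g R Z)) := by
  have := (hg.summable_drift hZ hg.base_mem).hasSum.tendsto_sum_nat.const_add
    (Z - ((R + 1 : ℝ) : ℂ))
  refine this.congr fun n => ?_
  rw [sum_drift]; ring

theorem norm_fatou_sub_le (hg : IsNearTranslation g C R) {Z W : ℂ} (hZ : Z ∈ cone (3 / 10) R)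
    (hW : W ∈ cone (3 / 10) R) :
    ‖fatou g R Z - fatou g R W - (Z - W)‖ ≤ 1 / 20 * ‖Z - W‖ := by
  have h1 := (hg.tendsto_fatou hZ).sub (hg.tendsto_fatou hW)
  have h2 := (hg.summable_drift hZ hW).hasSum.tendsto_sum_nat
  have h3 : fatou g R Z - fatou g R W - (Z - W) = ∑' n, drift g Z W n := by
    refine tendsto_nhds_unique (h1.sub_const (Z - W)) (h2.congr fun n => ?_)
    rw [sum_drift]; ring
  rw [h3]
  exact hg.norm_tsum_drift_le hZ hW

theorem mapsTo_cone (hg : IsNearTranslation g C R) {Z : ℂ} (hZ : Z ∈ cone (3 / 10) R) :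
    g Z ∈ cone (3 / 10) R :=
  ⟨by linarith [(hg.mapsTo le_rfl hZ).1], (hg.mapsTo le_rfl hZ).2⟩

theorem fatou_abel (hg : IsNearTranslation g C R) {Z : ℂ} (hZ : Z ∈ cone (3 / 10) R) :
    fatou g R (g Z) = fatou g R Z + 1 := by
  have h1 := (hg.tendsto_fatou (hg.mapsTo_cone hZ)).sub (hg.tendsto_fatou hZ)
  have h2 : Filter.Tendsto (fun n => g (g^[n] Z) - g^[n] Z - 1) Filter.atTop (nhds 0) := by
    refine squeeze_zero_norm (a := fun n : ℕ => C / (R + n / 2)) (fun n => ?_) ?_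
    · have hm := hg.iterate_mem hZ n
      have hR := hg.one_le
      have h0 := hg.nonneg
      have hn : (0 : ℝ) ≤ n := n.cast_nonneg
      refine (hg.bound _ (cone_subset (x := R + n / 2) (by linarith)
        (cone_subset_cone (by linarith) hm))).trans ?_
      gcongr
      exact hm.1.le
    · refine Filter.Tendsto.div_atTop tendsto_const_nhds ?_
      exact Filter.tendsto_atTop_add_const_left _ _
        (tendsto_natCast_atTop_atTop.atTop_div_const (by norm_num))
  have h3 : fatou g R (g Z) - fatou g R Z = 0 + 1 := by
    refine tendsto_nhds_unique h1 ((h2.add_const 1).congr fun n => ?_)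
    rw [← Function.iterate_succ_apply, Function.iterate_succ_apply']; ring
  rw [zero_add] at h3
  rw [← h3]; ring

theorem differentiableAt_iterate (hg : IsNearTranslation g C R) {Z : ℂ}
    (hZ : Z ∈ cone (3 / 10) R) (n : ℕ) : DifferentiableAt ℂ g^[n] Z := by
  have hR := hg.one_le
  induction n with
  | zero => exact differentiableAt_id
  | succ n ih =>
    rw [Function.iterate_succ']
    have hn : (0 : ℝ) ≤ n := n.cast_nonneg
    exact (hg.diff _ (cone_subset (x := R + n / 2) (by linarith)
      (cone_subset_cone (by linarith) (hg.iterate_mem hZ n)))).comp Z ih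

theorem differentiableAt_fatou (hg : IsNearTranslation g C R) {Z : ℂ}
    (hZ : Z ∈ cone (3 / 10) R) : DifferentiableAt ℂ (fatou g R) Z := by
  have h0 := hg.nonneg
  set b : ℂ := ((R + 1 : ℝ) : ℂ) with hb
  -- On a bounded piece of the cone the terms of the series have a common summable bound.
  set U : Set ℂ := cone (3 / 10) R ∩ Metric.ball b (‖Z - b‖ + 1) with hU
  have hUo : IsOpen U := (isOpen_cone _ _).inter Metric.isOpen_ball
  have hZU : Z ∈ U := ⟨hZ, by rw [mem_ball_iff_norm]; linarith⟩
  have h1 : DifferentiableOn ℂ (fun W => ∑' n, drift g W b n) U := by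
    refine Complex.differentiableOn_tsum_of_summable_norm
      (u := fun n : ℕ => 80 * C * (‖Z - b‖ + 1) * (1 / (R + n / 2) ^ 2))
      ((summable_inv_sq hg.one_le).mul_left _) (fun n W hW => ?_) hUo (fun n W hW => ?_)
    · have e : (fun W => drift g W b n) = fun W => (g^[n + 1] W - g^[n] W - 1) -
          (g (g^[n] b) - g^[n] b - 1) := by
        ext W; rw [drift, Function.iterate_succ_apply']
      rw [e]
      exact ((((hg.differentiableAt_iterate hW.1 (n + 1)).sub
        (hg.differentiableAt_iterate hW.1 n)).sub_const 1).sub_const _).differentiableWithinAt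
    · refine (hg.norm_drift_le hW.1 hg.base_mem n).trans ?_
      have := mem_ball_iff_norm.1 hW.2
      gcongr
  exact (differentiableAt_id.sub_const _).add (h1.differentiableAt (hUo.mem_nhds hZU))

theorem approximatesLinearOn_fatou (hg : IsNearTranslation g C R) :
    ApproximatesLinearOn (fatou g R) ((ContinuousLinearEquiv.refl ℂ ℂ : ℂ ≃L[ℂ] ℂ) : ℂ →L[ℂ] ℂ)
      (cone (3 / 10) R) (1 / 20) := by
  intro Z hZ W hW
  exact (hg.norm_fatou_sub_le hZ hW).trans (le_of_eq (by norm_num))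

theorem injOn_fatou (hg : IsNearTranslation g C R) :
    Set.InjOn (fatou g R) (cone (3 / 10) R) := by
  intro Z hZ W hW h
  have := hg.norm_fatou_sub_le hZ hW
  rw [h, sub_self, zero_sub, norm_neg] at this
  rw [← sub_eq_zero, ← norm_eq_zero]
  linarith [norm_nonneg (Z - W)]

theorem fatou_base (g : ℂ → ℂ) (R : ℝ) : fatou g R (R + 1 : ℝ) = 0 := by
  simp [fatou, drift]

/-- Every complex number is eventually translated into the image of the Fatou coordinate: the
latter is so close to a translation that the image of a large disc in the cone contains a disc
of comparable radius. -/
theorem exists_add_natCast_mem_image_fatou (hg : IsNearTranslation g C R) (t : ℂ) :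
    ∃ N : ℕ, t + N ∈ fatou g R '' cone (3 / 10) R := by
  have hR := hg.one_le
  obtain ⟨N, hN⟩ := exists_nat_ge (20 * (‖t‖ + R))
  have ht := norm_nonneg t
  have hN0 : (0 : ℝ) ≤ N := N.cast_nonneg
  set s : ℂ := t + N with hs
  have hsN : ‖s‖ ≤ ‖t‖ + N := (norm_add_le _ _).trans (by simp)
  have hre : s.re = t.re + N := by rw [hs]; simp
  have him : s.im = t.im := by rw [hs]; simp
  have htre := abs_le.1 (Complex.abs_re_le_norm t)
  have htim := abs_le.1 (Complex.abs_im_le_norm t)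
  set b : ℂ := (R + 1 : ℝ) + s with hb
  have hbre : b.re = R + 1 + (t.re + N) := by rw [hb, Complex.add_re, hre, Complex.ofReal_re]
  have hbim : b.im = t.im := by rw [hb, Complex.add_im, him, Complex.ofReal_im, zero_add]
  have hball : Metric.closedBall b (1 / 10 * ‖s‖) ⊆ cone (3 / 10) R := by
    intro W hW
    rw [mem_closedBall_iff_norm] at hW
    have h1 := abs_le.1 ((Complex.abs_re_le_norm (W - b)).trans hW)
    have h2 := abs_le.1 ((Complex.abs_im_le_norm (W - b)).trans hW)
    rw [Complex.sub_re, hbre] at h1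
    rw [Complex.sub_im, hbim] at h2
    exact ⟨by linarith, abs_lt.2 ⟨by linarith, by linarith⟩⟩
  have hbm : b ∈ cone (3 / 10) R := hball (Metric.mem_closedBall_self (by positivity))
  have hfb : ‖fatou g R b - s‖ ≤ 1 / 20 * ‖s‖ := by
    have := hg.norm_fatou_sub_le hbm hg.base_mem
    rw [fatou_base, hb] at this
    simpa [hb] using this
  have hsurj := hg.approximatesLinearOn_fatou.surjOn_closedBall_of_nonlinearRightInverse
    (ContinuousLinearEquiv.refl ℂ ℂ).toNonlinearRightInverse (b := b) (ε := 1 / 10 * ‖s‖)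
    (by positivity) hball
  have hmem : s ∈ Metric.closedBall (fatou g R b)
      (((((ContinuousLinearEquiv.refl ℂ ℂ : ℂ ≃L[ℂ] ℂ).toNonlinearRightInverse.nnnorm : ℝ))⁻¹ -
        ((1 / 20 : NNReal) : ℝ)) * (1 / 10 * ‖s‖)) := by
    rw [mem_closedBall_iff_norm, norm_sub_rev]
    refine hfb.trans ?_
    have : ((ContinuousLinearEquiv.refl ℂ ℂ : ℂ ≃L[ℂ] ℂ).toNonlinearRightInverse.nnnorm : ℝ) = 1 := by
      change ‖((ContinuousLinearEquiv.refl ℂ ℂ : ℂ ≃L[ℂ] ℂ).symm : ℂ →L[ℂ] ℂ)‖ = 1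
      exact ContinuousLinearMap.norm_id
    rw [this]
    push_cast
    nlinarith [norm_nonneg s]
  obtain ⟨W, hW, hWs⟩ := hsurj hmem
  exact ⟨N, W, hball hW, hWs⟩

theorem deriv_fatou_ne_zero (hg : IsNearTranslation g C R) {Z : ℂ} (hZ : Z ∈ cone (3 / 10) R) :
    deriv (fatou g R) Z ≠ 0 := by
  intro h
  have h1 : HasDerivAt (fun W => fatou g R W - W) (0 - 1) Z := by
    have := (hg.differentiableAt_fatou hZ).hasDerivAt
    rw [h] at this
    exact this.sub (hasDerivAt_id Z)
  have h2 := h1.le_of_lip' (C := 1 / 20) (by norm_num) (by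
    filter_upwards [(isOpen_cone _ _).mem_nhds hZ] with W hW
    refine le_trans (le_of_eq ?_) (hg.norm_fatou_sub_le hW hZ)
    congr 1; ring)
  norm_num at h2

/-- The Fatou coordinate has a holomorphic inverse on its image, which is open. -/
theorem exists_inverse_fatou (hg : IsNearTranslation g C R) :
    IsOpen (fatou g R '' cone (3 / 10) R) ∧ ∃ χ : ℂ → ℂ,
      ∀ t ∈ fatou g R '' cone (3 / 10) R,
        χ t ∈ cone (3 / 10) R ∧ fatou g R (χ t) = t ∧ DifferentiableAt ℂ χ t := by
  have hc : (1 / 20 : NNReal) <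
      ‖((ContinuousLinearEquiv.refl ℂ ℂ).symm : ℂ →L[ℂ] ℂ)‖₊⁻¹ := by
    have : ‖((ContinuousLinearEquiv.refl ℂ ℂ).symm : ℂ →L[ℂ] ℂ)‖₊ = 1 :=
      NNReal.eq ContinuousLinearMap.norm_id
    rw [this, ← NNReal.coe_lt_coe]
    norm_num
  let e := hg.approximatesLinearOn_fatou.toOpenPartialHomeomorph (fatou g R) (cone (3 / 10) R)
    (Or.inr hc) (isOpen_cone _ _)
  refine ⟨e.open_target, e.symm, fun t ht => ?_⟩
  have h1 : e.symm t ∈ cone (3 / 10) R := e.map_target ht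
  have h2 : fatou g R (e.symm t) = t := e.right_inv ht
  refine ⟨h1, h2, ?_⟩
  refine (HasDerivAt.of_local_left_inverse (e.continuousAt_symm ht)
    (hg.differentiableAt_fatou h1).hasDerivAt (hg.deriv_fatou_ne_zero h1) ?_).differentiableAt
  filter_upwards [e.open_target.mem_nhds ht] with s hs using e.right_inv hs

end IsNearTranslation

/-! ### The dynamics on a parabolic graph -/

theorem mem_graphCurve_iff {ε : ℝ} {γ : ℂ → ℂ} {p : ℂ × ℂ} :
    p ∈ graphCurve ε γ ↔ p.1 ∈ sector ε ∧ p = (p.1, γ p.1) := by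
  constructor
  · rintro ⟨z, hz, rfl⟩
    exact ⟨hz, rfl⟩
  · rintro ⟨h1, h2⟩
    exact ⟨p.1, h1, h2.symm⟩

theorem iterate_mem_graphCurve {F : ℂ × ℂ → ℂ × ℂ} {ε : ℝ} {γ : ℂ → ℂ}
    (hγ : IsParabolicGraph F ε γ) {p : ℂ × ℂ} (hp : p ∈ graphCurve ε γ) (n : ℕ) :
    F^[n] p ∈ graphCurve ε γ :=
  hγ.invariant.iterate n hp

theorem image_globalCurve {F : ℂ × ℂ ≃ ℂ × ℂ} {ε : ℝ} {γ : ℂ → ℂ}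
    (hγ : IsParabolicGraph F ε γ) : F '' globalCurve F ε γ = globalCurve F ε γ := by
  ext p
  simp only [globalCurve, Set.mem_image, Set.mem_iUnion, Set.mem_preimage]
  constructor
  · rintro ⟨q, ⟨n, hn⟩, rfl⟩
    refine ⟨n, ?_⟩
    rw [← Function.iterate_succ_apply, Function.iterate_succ_apply']
    exact hγ.invariant hn
  · rintro ⟨n, hn⟩
    refine ⟨F.symm p, ⟨n + 1, ?_⟩, F.apply_symm_apply p⟩
    rwa [Function.iterate_succ_apply, F.apply_symm_apply]

theorem curveMap_isBigO {F : ℂ × ℂ ≃ ℂ × ℂ} (hF : IsSpecialAutomorphism F) {ε : ℝ} {γ : ℂ → ℂ}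
    (hγ : IsParabolicGraph F ε γ) :
    (fun z : ℂ => curveMap F γ z - (z + z ^ 2))
      =O[nhdsWithin 0 (sector ε)] (fun z : ℂ => z ^ 3) := by
  have hle : ∀ᶠ z in nhdsWithin 0 (sector ε), ‖γ z‖ ≤ ‖z‖ := by
    filter_upwards [hγ.tangent.norm.eventually
      (gt_mem_nhds (show ‖(0 : ℂ)‖ < 1 by simp)), self_mem_nhdsWithin] with z hz hzs
    rw [norm_div, div_lt_one (mem_sector_iff.1 hzs).1] at hz
    exact hz.le
  have hid : Filter.Tendsto (fun z : ℂ => z) (nhdsWithin 0 (sector ε)) (nhds 0) :=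
    tendsto_nhdsWithin_of_tendsto_nhds Filter.tendsto_id
  have hγ0 : Filter.Tendsto γ (nhdsWithin 0 (sector ε)) (nhds 0) :=
    squeeze_zero_norm' hle (by simpa using hid.norm)
  have ht : Filter.Tendsto (fun z => (z, γ z)) (nhdsWithin 0 (sector ε)) (nhds (0 : ℂ × ℂ)) :=
    hid.prodMk_nhds hγ0
  refine (hF.germ_fst.comp_tendsto ht).trans ?_
  refine Asymptotics.IsBigO.of_bound 2 ?_
  filter_upwards [hle] with z hz
  simp only [Function.comp, norm_pow]
  rw [Real.norm_of_nonneg (by positivity)]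
  nlinarith [mul_le_mul_of_nonneg_left hz (sq_nonneg ‖z‖)]

theorem differentiableAt_curveMap {F : ℂ × ℂ ≃ ℂ × ℂ} (hF : IsSpecialAutomorphism F) {ε : ℝ}
    {γ : ℂ → ℂ} (hγ : IsParabolicGraph F ε γ) {z : ℂ} (hz : z ∈ sector ε) :
    DifferentiableAt ℂ (curveMap F γ) z := by
  have h1 : DifferentiableAt ℂ γ z := hγ.holo.differentiableAt ((isOpen_sector ε).mem_nhds hz)
  have h2 : DifferentiableAt ℂ (fun z => F (z, γ z)) z :=
    (hF.holo (z, γ z)).comp z (differentiableAt_id.prodMk h1)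
  exact h2.fst

/-- The action of `F` on the curve, read in the coordinate `Z = -1/z`. -/
noncomputable def curveMapAtInfinity (F : ℂ × ℂ → ℂ × ℂ) (γ : ℂ → ℂ) (Z : ℂ) : ℂ :=
  -(curveMap F γ (-Z⁻¹))⁻¹

/-- The coordinate `Z = -1/z` of the first component of a point. -/
noncomputable def coordAtInfinity (p : ℂ × ℂ) : ℂ := -p.1⁻¹

theorem exists_curveMap_bound {F : ℂ × ℂ ≃ ℂ × ℂ} (hF : IsSpecialAutomorphism F) {ε : ℝ}
    {γ : ℂ → ℂ} (hγ : IsParabolicGraph F ε γ) :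
    ∃ C δ : ℝ, 0 ≤ C ∧ 0 < δ ∧ ∀ z ∈ sector ε, ‖z‖ < δ →
      ‖-(curveMap F γ z)⁻¹ - (-z⁻¹) - 1‖ ≤ C * ‖z‖ := by
  obtain ⟨c, hc0, hc⟩ := (curveMap_isBigO hF hγ).exists_nonneg
  obtain ⟨δ, hδ, hball⟩ := Metric.mem_nhdsWithin_iff.1 hc.bound
  refine ⟨4 * (c + 1), min δ (min (1 / 4) (1 / (c + 1))), by positivity, by positivity,
    fun z hz hzδ => ?_⟩
  obtain ⟨h1, h2, h3⟩ : ‖z‖ < δ ∧ ‖z‖ < 1 / 4 ∧ ‖z‖ < 1 / (c + 1) := by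
    simpa [lt_min_iff] using hzδ
  have hb : ‖curveMap F γ z - (z + z ^ 2)‖ ≤ c * ‖z ^ 3‖ :=
    hball ⟨by simpa using h1, hz⟩
  rw [lt_div_iff₀ (by positivity)] at h3
  have := (neg_inv_add_inv_sub_one (f := curveMap F γ z) (c := c * ‖z‖)
    (norm_pos_iff.1 (mem_sector_iff.1 hz).1) h2.le (by nlinarith [norm_nonneg z]) ?_).2
  · refine this.trans (le_of_eq (by ring))
  · rw [norm_pow] at hb
    exact hb.trans (le_of_eq (by ring))

theorem exists_isNearTranslation {F : ℂ × ℂ ≃ ℂ × ℂ} (hF : IsSpecialAutomorphism F) {ε : ℝ}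
    (hε : 0 < ε) {γ : ℂ → ℂ} (hγ : IsParabolicGraph F ε γ) :
    ∃ C R : ℝ, 2 / ε ≤ R ∧ IsNearTranslation (curveMapAtInfinity F γ) C R := by
  obtain ⟨C, δ, hC, hδ, hb⟩ := exists_curveMap_bound hF hγ
  set R : ℝ := max (max 1 (6400 * C)) (max (2 / ε) (2 / δ)) with hRdef
  have hR1 : 1 ≤ R := (le_max_left _ _).trans (le_max_left _ _)
  have hR2 : 6400 * C ≤ R := (le_max_right _ _).trans (le_max_left _ _)
  have hR3 : 2 / ε ≤ R := (le_max_left _ _).trans (le_max_right _ _)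
  have hR4 : 2 / δ ≤ R := (le_max_right _ _).trans (le_max_right _ _)
  have hsec : ∀ Z ∈ cone (2 / 5) (R / 2), -Z⁻¹ ∈ sector ε := by
    intro Z hZ
    refine neg_inv_mem_sector_of_mem_cone hε ⟨lt_of_le_of_lt ?_ hZ.1, hZ.2⟩
    have : 2 / ε = 2 * (1 / ε) := by ring
    linarith
  refine ⟨C, R, hR3, hR1, hC, hR2, fun Z hZ => ?_, fun Z hZ => ?_⟩
  · have hs := hsec Z hZ
    have hZ0 : Z ≠ 0 := by
      rintro rfl
      have := hZ.1
      rw [Complex.zero_re] at this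
      linarith
    have hne : curveMap F γ (-Z⁻¹) ≠ 0 := by
      have : (F (-Z⁻¹, γ (-Z⁻¹))) ∈ graphCurve ε γ := hγ.invariant ⟨_, hs, rfl⟩
      exact norm_pos_iff.1 (mem_sector_iff.1 (mem_graphCurve_iff.1 this).1).1
    have hd : DifferentiableAt ℂ (fun Z => curveMap F γ (-Z⁻¹)) Z :=
      DifferentiableAt.comp Z (g := curveMap F γ) (differentiableAt_curveMap hF hγ hs)
        (differentiableAt_inv hZ0).fun_neg
    exact (hd.fun_inv hne).neg
  · have hZre : 0 < Z.re := by linarith [hZ.1]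
    have hZn : Z.re ≤ ‖Z‖ := Complex.re_le_norm Z
    have hsmall : ‖-Z⁻¹‖ < δ := by
      rw [norm_neg, norm_inv, inv_lt_comm₀ (by linarith) hδ]
      have : 2 / δ = 2 * δ⁻¹ := by ring
      linarith [hZ.1]
    have := hb _ (hsec Z hZ) hsmall
    rw [inv_neg, inv_inv, neg_neg, norm_neg, norm_inv] at this
    refine this.trans ?_
    rw [div_eq_mul_inv]
    gcongr

/-- Along an orbit on the curve the increments of the coordinate `-1/z` tend to `1`. -/
theorem tendsto_coordAtInfinity_sub {F : ℂ × ℂ ≃ ℂ × ℂ} (hF : IsSpecialAutomorphism F) {ε : ℝ}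
    {γ : ℂ → ℂ} (hγ : IsParabolicGraph F ε γ) {p : ℂ × ℂ} (hp : p ∈ graphCurve ε γ) :
    Filter.Tendsto (fun n => coordAtInfinity (F^[n + 1] p) - coordAtInfinity (F^[n] p))
      Filter.atTop (nhds 1) := by
  obtain ⟨C, δ, hC, hδ, hb⟩ := exists_curveMap_bound hF hγ
  have h0 : Filter.Tendsto (fun n => ‖(F^[n] p).1‖) Filter.atTop (nhds 0) := by
    have := ((continuous_fst.tendsto _).comp (hγ.attracted p hp)).norm
    simpa using this
  rw [tendsto_iff_norm_sub_tendsto_zero]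
  refine squeeze_zero_norm' (a := fun n => C * ‖(F^[n] p).1‖) ?_ (by simpa using h0.const_mul C)
  filter_upwards [h0.eventually (gt_mem_nhds hδ)] with n hn
  obtain ⟨hs, he⟩ := mem_graphCurve_iff.1 (iterate_mem_graphCurve hγ hp n)
  have := hb _ hs hn
  rw [norm_norm, Function.iterate_succ_apply']
  refine le_trans (le_of_eq ?_) this
  rw [coordAtInfinity, coordAtInfinity, curveMap, ← he]

/-! ### The global Fatou coordinate -/

section GlobalFatou

variable {F : ℂ × ℂ ≃ ℂ × ℂ} {ε : ℝ} {γ : ℂ → ℂ} {C R : ℝ}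

/-- After `N` steps the orbit of `p` lies on the part of the curve on which the Fatou coordinate
has been constructed. -/
def ReachesCone (F : ℂ × ℂ ≃ ℂ × ℂ) (ε : ℝ) (γ : ℂ → ℂ) (R : ℝ) (N : ℕ) (p : ℂ × ℂ) : Prop :=
  F^[N] p ∈ graphCurve ε γ ∧ coordAtInfinity (F^[N] p) ∈ cone (3 / 10) R

theorem coordAtInfinity_apply {p : ℂ × ℂ} (hp : p ∈ graphCurve ε γ) :
    coordAtInfinity (F p) = curveMapAtInfinity F γ (coordAtInfinity p) := by
  have he := (mem_graphCurve_iff.1 hp).2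
  rw [curveMapAtInfinity, coordAtInfinity, coordAtInfinity, inv_neg, inv_inv, neg_neg, curveMap,
    ← he]

theorem ReachesCone.succ (hγ : IsParabolicGraph F ε γ)
    (hg : IsNearTranslation (curveMapAtInfinity F γ) C R) {N : ℕ} {p : ℂ × ℂ}
    (h : ReachesCone F ε γ R N p) : ReachesCone F ε γ R (N + 1) p := by
  rw [ReachesCone, Function.iterate_succ_apply', coordAtInfinity_apply h.1]
  exact ⟨hγ.invariant h.1, hg.mapsTo_cone h.2⟩

theorem ReachesCone.mono (hγ : IsParabolicGraph F ε γ)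
    (hg : IsNearTranslation (curveMapAtInfinity F γ) C R) {N M : ℕ} (hNM : N ≤ M) {p : ℂ × ℂ}
    (h : ReachesCone F ε γ R N p) : ReachesCone F ε γ R M p := by
  induction hNM with
  | refl => exact h
  | step _ ih => exact ih.succ hγ hg

theorem ReachesCone.fatou_eq (hγ : IsParabolicGraph F ε γ)
    (hg : IsNearTranslation (curveMapAtInfinity F γ) C R) {N M : ℕ} (hNM : N ≤ M) {p : ℂ × ℂ}
    (h : ReachesCone F ε γ R N p) :
    IsNearTranslation.fatou (curveMapAtInfinity F γ) R (coordAtInfinity (F^[M] p)) - M =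
      IsNearTranslation.fatou (curveMapAtInfinity F γ) R (coordAtInfinity (F^[N] p)) - N := by
  induction hNM with
  | refl => rfl
  | @step m hm ih =>
    have hm' := h.mono hγ hg hm
    rw [← ih, Function.iterate_succ_apply', coordAtInfinity_apply hm'.1, hg.fatou_abel hm'.2]
    push_cast; ring

theorem exists_reachesCone (hF : IsSpecialAutomorphism F) (hγ : IsParabolicGraph F ε γ)
    {p : ℂ × ℂ} (hp : p ∈ globalCurve F ε γ) : ∃ N, ReachesCone F ε γ R N p := by
  obtain ⟨m, hm'⟩ := Set.mem_iUnion.1 hp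
  have hm : F^[m] p ∈ graphCurve ε γ := hm'
  have hev := eventually_mem_cone
    (u := fun n => coordAtInfinity (F^[n] (F^[m] p))) (tendsto_coordAtInfinity_sub hF hγ hm)
    (show (0 : ℝ) < 3 / 10 by norm_num) R
  obtain ⟨n, hn⟩ := hev.exists
  refine ⟨n + m, ?_⟩
  unfold ReachesCone
  rw [Function.iterate_add_apply]
  exact ⟨iterate_mem_graphCurve hγ hm n, hn⟩

theorem ReachesCone.mem_globalCurve {N : ℕ} {p : ℂ × ℂ} (h : ReachesCone F ε γ R N p) :
    p ∈ globalCurve F ε γ :=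
  Set.mem_iUnion.2 ⟨N, h.1⟩

open Classical in
/-- The extension of the Fatou coordinate to the global curve: `ζ(Fᴺ p) - N` for any `N` for
which `Fᴺ p` lies on the part of the curve where the Fatou coordinate `ζ` has been
constructed. -/
noncomputable def globalFatou (F : ℂ × ℂ ≃ ℂ × ℂ) (ε : ℝ) (γ : ℂ → ℂ) (R : ℝ) (p : ℂ × ℂ) : ℂ :=
  if h : ∃ N, ReachesCone F ε γ R N p then
    IsNearTranslation.fatou (curveMapAtInfinity F γ) R (coordAtInfinity (F^[h.choose] p)) - h.choose
  else 0

theorem globalFatou_eq (hγ : IsParabolicGraph F ε γ)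
    (hg : IsNearTranslation (curveMapAtInfinity F γ) C R) {N : ℕ} {p : ℂ × ℂ}
    (h : ReachesCone F ε γ R N p) : globalFatou F ε γ R p =
      IsNearTranslation.fatou (curveMapAtInfinity F γ) R (coordAtInfinity (F^[N] p)) - N := by
  have hex : ∃ N, ReachesCone F ε γ R N p := ⟨N, h⟩
  rw [globalFatou, dif_pos hex]
  rcases le_total N hex.choose with hle | hle
  · exact h.fatou_eq hγ hg hle
  · exact (hex.choose_spec.fatou_eq hγ hg hle).symm

theorem globalFatou_apply (hF : IsSpecialAutomorphism F) (hγ : IsParabolicGraph F ε γ)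
    (hg : IsNearTranslation (curveMapAtInfinity F γ) C R) {p : ℂ × ℂ}
    (hp : p ∈ globalCurve F ε γ) : globalFatou F ε γ R (F p) = globalFatou F ε γ R p + 1 := by
  obtain ⟨N, hN⟩ := exists_reachesCone (R := R) hF hγ hp
  have h1 := hN.succ hγ hg
  have h2 : ReachesCone F ε γ R N (F p) := h1
  rw [globalFatou_eq hγ hg h1, globalFatou_eq hγ hg h2, Function.iterate_succ_apply]
  push_cast; ring

theorem globalFatou_iterate (hF : IsSpecialAutomorphism F) (hγ : IsParabolicGraph F ε γ)
    (hg : IsNearTranslation (curveMapAtInfinity F γ) C R) {p : ℂ × ℂ}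
    (hp : p ∈ globalCurve F ε γ) (n : ℕ) :
    F^[n] p ∈ globalCurve F ε γ ∧ globalFatou F ε γ R (F^[n] p) = globalFatou F ε γ R p + n := by
  induction n with
  | zero => exact ⟨hp, by simp⟩
  | succ n ih =>
    rw [Function.iterate_succ_apply', globalFatou_apply hF hγ hg ih.1, ih.2]
    refine ⟨?_, by push_cast; ring⟩
    rw [← image_globalCurve hγ]
    exact Set.mem_image_of_mem _ ih.1

theorem coordAtInfinity_injOn {p q : ℂ × ℂ} (hp : p ∈ graphCurve ε γ) (hq : q ∈ graphCurve ε γ)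
    (h : coordAtInfinity p = coordAtInfinity q) : p = q := by
  have h1 : p.1 = q.1 := inv_injective (neg_injective h)
  rw [(mem_graphCurve_iff.1 hp).2, (mem_graphCurve_iff.1 hq).2, h1]

theorem globalFatou_injOn (hF : IsSpecialAutomorphism F) (hγ : IsParabolicGraph F ε γ)
    (hg : IsNearTranslation (curveMapAtInfinity F γ) C R) :
    Set.InjOn (globalFatou F ε γ R) (globalCurve F ε γ) := by
  intro p hp q hq h
  obtain ⟨N, hN⟩ := exists_reachesCone (R := R) hF hγ hp
  obtain ⟨M, hM⟩ := exists_reachesCone (R := R) hF hγ hq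
  have hN' := hN.mono hγ hg (le_max_left N M)
  have hM' := hM.mono hγ hg (le_max_right N M)
  rw [globalFatou_eq hγ hg hN', globalFatou_eq hγ hg hM', sub_left_inj] at h
  exact (F.injective.iterate _)
    (coordAtInfinity_injOn hN'.1 hM'.1 (hg.injOn_fatou hN'.2 hM'.2 h))

theorem iterate_pieceParam (F : ℂ × ℂ ≃ ℂ × ℂ) (γ : ℂ → ℂ) (n : ℕ) (z : ℂ) :
    F^[n] (pieceParam F γ n z) = (z, γ z) :=
  (Function.RightInverse.iterate F.right_inv n) (z, γ z)

theorem reachesCone_pieceParam (hε : 0 < ε) (hR : 2 / ε ≤ R) {Z : ℂ} (hZ : Z ∈ cone (3 / 10) R)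
    (N : ℕ) : ReachesCone F ε γ R N (pieceParam F γ N (-Z⁻¹)) := by
  have h0 : 0 < 2 / ε := by positivity
  have h1 : 2 / ε = 1 / ε + 1 / ε := by ring
  have h2 : 0 < 1 / ε := by positivity
  rw [ReachesCone, iterate_pieceParam]
  refine ⟨⟨-Z⁻¹, neg_inv_mem_sector_of_mem_cone hε ?_, rfl⟩, ?_⟩
  · exact ⟨by linarith [hZ.1], by linarith [hZ.1, hZ.2]⟩
  · rw [coordAtInfinity, inv_neg, inv_inv, neg_neg]
    exact hZ

theorem globalFatou_pieceParam (hγ : IsParabolicGraph F ε γ)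
    (hg : IsNearTranslation (curveMapAtInfinity F γ) C R) (hε : 0 < ε) (hR : 2 / ε ≤ R) {Z : ℂ}
    (hZ : Z ∈ cone (3 / 10) R) (N : ℕ) :
    globalFatou F ε γ R (pieceParam F γ N (-Z⁻¹)) =
      IsNearTranslation.fatou (curveMapAtInfinity F γ) R Z - N := by
  rw [globalFatou_eq hγ hg (reachesCone_pieceParam hε hR hZ N), iterate_pieceParam,
    coordAtInfinity, inv_neg, inv_inv, neg_neg]

theorem exists_globalFatou_eq (hγ : IsParabolicGraph F ε γ)
    (hg : IsNearTranslation (curveMapAtInfinity F γ) C R) (hε : 0 < ε) (hR : 2 / ε ≤ R) (t : ℂ) :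
    ∃ p ∈ globalCurve F ε γ, globalFatou F ε γ R p = t := by
  obtain ⟨N, Z, hZ, hN⟩ := hg.exists_add_natCast_mem_image_fatou t
  refine ⟨_, (reachesCone_pieceParam hε hR hZ N).mem_globalCurve, ?_⟩
  rw [globalFatou_pieceParam hγ hg hε hR hZ N, hN]; ring

/-- The Fatou coordinate on the sector, obtained by restricting the global one. -/
noncomputable def sectorFatou (F : ℂ × ℂ ≃ ℂ × ℂ) (ε : ℝ) (γ : ℂ → ℂ) (R : ℝ) (z : ℂ) : ℂ :=
  globalFatou F ε γ R (z, γ z)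

theorem mem_globalCurve_of_mem_sector {z : ℂ} (hz : z ∈ sector ε) :
    (z, γ z) ∈ globalCurve F ε γ :=
  Set.mem_iUnion.2 ⟨0, ⟨z, hz, rfl⟩⟩

theorem globalFatou_eq_sectorFatou (hF : IsSpecialAutomorphism F) (hγ : IsParabolicGraph F ε γ)
    (hg : IsNearTranslation (curveMapAtInfinity F γ) C R) {p : ℂ × ℂ} {N : ℕ}
    (hp : F^[N] p ∈ graphCurve ε γ) :
    globalFatou F ε γ R p = sectorFatou F ε γ R (F^[N] p).1 - N := by
  have h := (globalFatou_iterate hF hγ hg (Set.mem_iUnion.2 ⟨N, hp⟩) N).2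
  rw [sectorFatou, ← (mem_graphCurve_iff.1 hp).2, h]; ring

theorem differentiableAt_iterate_graph (hF : IsSpecialAutomorphism F)
    (hγ : IsParabolicGraph F ε γ) {z : ℂ} (hz : z ∈ sector ε) (N : ℕ) :
    DifferentiableAt ℂ (fun z => F^[N] (z, γ z)) z := by
  have h1 : DifferentiableAt ℂ γ z := hγ.holo.differentiableAt ((isOpen_sector ε).mem_nhds hz)
  have h2 : Differentiable ℂ F^[N] := hF.holo.iterate N
  exact (h2 (z, γ z)).comp z (differentiableAt_id.prodMk h1)

theorem differentiableAt_sectorFatou (hF : IsSpecialAutomorphism F) (hγ : IsParabolicGraph F ε γ)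
    (hg : IsNearTranslation (curveMapAtInfinity F γ) C R) {z : ℂ} (hz : z ∈ sector ε) :
    DifferentiableAt ℂ (sectorFatou F ε γ R) z := by
  obtain ⟨N, hN⟩ := exists_reachesCone (R := R) hF hγ (mem_globalCurve_of_mem_sector hz)
  have hd : DifferentiableAt ℂ (fun z => coordAtInfinity (F^[N] (z, γ z))) z := by
    refine (DifferentiableAt.inv (differentiableAt_iterate_graph hF hγ hz N).fst ?_).neg
    exact norm_pos_iff.1 (mem_sector_iff.1 (mem_graphCurve_iff.1 hN.1).1).1
  have hd2 := ((hg.differentiableAt_fatou hN.2).comp z hd).sub_const (N : ℂ)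
  refine hd2.congr_of_eventuallyEq ?_
  filter_upwards [(isOpen_sector ε).mem_nhds hz,
    hd.continuousAt.preimage_mem_nhds ((isOpen_cone _ _).mem_nhds hN.2)] with w hw hw2
  exact globalFatou_eq hγ hg ⟨iterate_mem_graphCurve hγ ⟨w, hw, rfl⟩ N, hw2⟩

theorem sectorFatou_injOn (hF : IsSpecialAutomorphism F) (hγ : IsParabolicGraph F ε γ)
    (hg : IsNearTranslation (curveMapAtInfinity F γ) C R) :
    Set.InjOn (sectorFatou F ε γ R) (sector ε) := by
  intro z hz w hw h
  exact congrArg Prod.fst (globalFatou_injOn hF hγ hg (mem_globalCurve_of_mem_sector hz)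
    (mem_globalCurve_of_mem_sector hw) h)

theorem isFatouCoordinate_sectorFatou (hF : IsSpecialAutomorphism F)
    (hγ : IsParabolicGraph F ε γ) (hg : IsNearTranslation (curveMapAtInfinity F γ) C R) :
    IsFatouCoordinate (curveMap F γ) (sector ε) (sectorFatou F ε γ R) where
  holo := fun _ hz => (differentiableAt_sectorFatou hF hγ hg hz).differentiableWithinAt
  inj := sectorFatou_injOn hF hγ hg
  abel := fun z hz => by
    have h1 : F (z, γ z) ∈ graphCurve ε γ := hγ.invariant ⟨z, hz, rfl⟩
    have h2 := globalFatou_apply hF hγ hg (mem_globalCurve_of_mem_sector hz)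
    rw [sectorFatou, sectorFatou, ← h2, curveMap, ← (mem_graphCurve_iff.1 h1).2]

theorem isOpen_image_sectorFatou (hF : IsSpecialAutomorphism F) (hγ : IsParabolicGraph F ε γ)
    (hg : IsNearTranslation (curveMapAtInfinity F γ) C R) :
    IsOpen (sectorFatou F ε γ R '' sector ε) := by
  rw [isOpen_iff_mem_nhds]
  rintro _ ⟨z, hz, rfl⟩
  have hs := (isOpen_sector ε).mem_nhds hz
  have han : AnalyticAt ℂ (sectorFatou F ε γ R) z :=
    (isFatouCoordinate_sectorFatou hF hγ hg).holo.analyticAt hs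
  rcases han.eventually_constant_or_nhds_le_map_nhds with h | h
  · exfalso
    have h1 : ∀ᶠ w in nhds z, w = z := by
      filter_upwards [h, hs] with w hw hws
      exact sectorFatou_injOn hF hγ hg hws hz hw
    have h2 : ∀ᶠ w in nhdsWithin z {z}ᶜ, w = z := h1.filter_mono nhdsWithin_le_nhds
    obtain ⟨w, hw1, hw2⟩ := (h2.and self_mem_nhdsWithin).exists
    exact hw2 hw1
  · exact h (Filter.image_mem_map hs)

/-- The global Fatou coordinate maps the global curve biholomorphically onto the plane. -/
theorem exists_isBiholomorphismOntoPlane (hF : IsSpecialAutomorphism F)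
    (hγ : IsParabolicGraph F ε γ) (hg : IsNearTranslation (curveMapAtInfinity F γ) C R)
    (hε : 0 < ε) (hR : 2 / ε ≤ R) :
    ∃ ψ, IsBiholomorphismOntoPlane F ε γ (globalFatou F ε γ R) ψ := by
  choose ψ hmem hright using exists_globalFatou_eq hγ hg hε hR
  have hleft : ∀ p ∈ globalCurve F ε γ, ψ (globalFatou F ε γ R p) = p := fun p hp =>
    globalFatou_injOn hF hγ hg (hmem _) hp (hright _)
  obtain ⟨hopen, χ, hχ⟩ := hg.exists_inverse_fatou
  -- Near any point `ψ` is the composition of a translation, the inverse of the Fatou coordinate,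
  -- the parametrization of the curve and an iterate of the inverse of `F`.
  have hlocal : ∀ t : ℂ, DifferentiableAt ℂ ψ t ∧ deriv ψ t ≠ 0 := by
    intro t
    obtain ⟨N, hN⟩ := hg.exists_add_natCast_mem_image_fatou t
    have hev : ∀ᶠ s : ℂ in nhds t, s + N ∈
        IsNearTranslation.fatou (curveMapAtInfinity F γ) R '' cone (3 / 10) R :=
      (continuous_id.add continuous_const).continuousAt.preimage_mem_nhds (hopen.mem_nhds hN)
    have hψ : ∀ s : ℂ, s + N ∈
        IsNearTranslation.fatou (curveMapAtInfinity F γ) R '' cone (3 / 10) R →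
        ψ s = pieceParam F γ N (-(χ (s + N))⁻¹) := by
      intro s hs
      obtain ⟨h1, h2, -⟩ := hχ _ hs
      refine globalFatou_injOn hF hγ hg (hmem s)
        (reachesCone_pieceParam hε hR h1 N).mem_globalCurve ?_
      rw [hright, globalFatou_pieceParam hγ hg hε hR h1 N, h2]; ring
    obtain ⟨hm, hfm, hdm⟩ := hχ _ hN
    have hsec : -(χ (t + N))⁻¹ ∈ sector ε := by
      have := (reachesCone_pieceParam (F := F) (γ := γ) hε hR hm N).1
      rw [iterate_pieceParam] at this
      exact (mem_graphCurve_iff.1 this).1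
    have hχ0 : χ (t + N) ≠ 0 := by
      intro h0
      rw [h0, inv_zero, neg_zero] at hsec
      exact absurd (mem_sector_iff.1 hsec).1 (by simp)
    have hχt : DifferentiableAt ℂ (fun s : ℂ => χ (s + N)) t :=
      hdm.comp t (differentiableAt_id.add_const _)
    have hz : DifferentiableAt ℂ (fun s : ℂ => -(χ (s + N))⁻¹) t := (hχt.fun_inv hχ0).neg
    have hγd : DifferentiableAt ℂ γ (-(χ (t + N))⁻¹) :=
      hγ.holo.differentiableAt ((isOpen_sector ε).mem_nhds hsec)
    have hψd : DifferentiableAt ℂ ψ t := by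
      have h1 : DifferentiableAt ℂ (fun s => pieceParam F γ N (-(χ (s + N))⁻¹)) t :=
        ((hF.holo_symm.iterate N) _).comp t (hz.prodMk (hγd.comp t hz))
      refine h1.congr_of_eventuallyEq ?_
      filter_upwards [hev] with s hs using hψ s hs
    refine ⟨hψd, fun hd0 => ?_⟩
    -- The map `ψ` composed with `Fᴺ` and the Fatou coordinate is a translation.
    have hψt : HasDerivAt ψ 0 t := hd0 ▸ hψd.hasDerivAt
    have hFN : Differentiable ℂ F^[N] := hF.holo.iterate N
    have hcoord : ∀ s : ℂ, s + N ∈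
        IsNearTranslation.fatou (curveMapAtInfinity F γ) R '' cone (3 / 10) R →
        coordAtInfinity (F^[N] (ψ s)) = χ (s + N) := by
      intro s hs
      rw [hψ s hs, iterate_pieceParam, coordAtInfinity, inv_neg, inv_inv, neg_neg]
    have hFψ : HasDerivAt (fun s => F^[N] (ψ s)) 0 t := by
      have := (hFN (ψ t)).hasFDerivAt.comp_hasDerivAt t hψt
      rwa [map_zero] at this
    have hne : (F^[N] (ψ t)).1 ≠ 0 := by
      rw [hψ t hN, iterate_pieceParam]
      exact neg_ne_zero.2 (inv_ne_zero hχ0)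
    have h2 : HasDerivAt (fun s => coordAtInfinity (F^[N] (ψ s))) 0 t := by
      have h3 : HasDerivAt (fun s => (F^[N] (ψ s)).1) 0 t := by
        have := (hasFDerivAt_fst (𝕜 := ℂ) (p := F^[N] (ψ t))).comp_hasDerivAt t hFψ
        rwa [map_zero] at this
      have := (h3.fun_inv hne).fun_neg
      rwa [neg_zero, zero_div, neg_zero] at this
    have h4 : HasDerivAt (fun s => IsNearTranslation.fatou (curveMapAtInfinity F γ) R
        (coordAtInfinity (F^[N] (ψ s)))) 0 t := by
      have hdf := (hg.differentiableAt_fatou hm).hasDerivAt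
      rw [← hcoord t hN] at hdf
      have := hdf.comp t h2
      rwa [mul_zero] at this
    have h5 : HasDerivAt (fun s : ℂ => s + N) 0 t := by
      refine h4.congr_of_eventuallyEq ?_
      filter_upwards [hev] with s hs
      rw [hcoord s hs, (hχ _ hs).2.1]
    exact one_ne_zero (((hasDerivAt_id t).add_const (N : ℂ)).unique h5)
  have hψdiff : Differentiable ℂ ψ := fun t => (hlocal t).1
  have hpiece : ∀ n : ℕ, ∀ z ∈ sector ε,
      globalFatou F ε γ R (pieceParam F γ n z) = sectorFatou F ε γ R z - n := by
    intro n z hz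
    have := globalFatou_eq_sectorFatou hF hγ hg (p := pieceParam F γ n z) (N := n)
      (by rw [iterate_pieceParam]; exact ⟨z, hz, rfl⟩)
    rwa [iterate_pieceParam] at this
  refine ⟨ψ, hmem, hright, hleft, fun n => ?_, fun n => ?_, fun n => ?_, hψdiff,
    fun t => (hlocal t).2⟩
  · exact ((isFatouCoordinate_sectorFatou hF hγ hg).holo.sub_const (n : ℂ)).congr (hpiece n)
  · have : ψ ⁻¹' (F^[n] ⁻¹' graphCurve ε γ) =
        (fun t : ℂ => t + n) ⁻¹' (sectorFatou F ε γ R '' sector ε) := by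
      ext t
      simp only [Set.mem_preimage]
      constructor
      · intro h
        refine ⟨(F^[n] (ψ t)).1, (mem_graphCurve_iff.1 h).1, ?_⟩
        have := globalFatou_eq_sectorFatou hF hγ hg h
        rw [hright] at this
        exact (eq_add_of_sub_eq this.symm)
      · rintro ⟨z, hz, hzt⟩
        have h1 : ψ t = pieceParam F γ n z := by
          have hm : F^[n] (pieceParam F γ n z) ∈ graphCurve ε γ := by
            rw [iterate_pieceParam]; exact ⟨z, hz, rfl⟩
          rw [← hleft _ (Set.mem_iUnion.2 ⟨n, hm⟩), hpiece n z hz, hzt, add_sub_cancel_right]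
        rw [h1, iterate_pieceParam]
        exact ⟨z, hz, rfl⟩
    rw [this]
    exact (isOpen_image_sectorFatou hF hγ hg).preimage (by fun_prop)
  · exact ((hF.holo.iterate n).comp hψdiff).fst.differentiableOn

end GlobalFatou

/-! ### Stable orbits by the Lyapunov–Perron method -/

/-- Points `(Z, w)` with `Re Z ≥ p` and `|w| ≤ 1/p²`. -/
def perronRegion (p : ℝ) : Set (ℂ × ℂ) := {q | p ≤ q.1.re ∧ ‖q.2‖ ≤ 1 / p ^ 2}

/-- Bounds on the nonlinear parts of the map `(Z, w) ↦ (Z + 1 + A(Z, w), w - G(Z, w))`, on all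
regions `{Re Z ≥ p, |w| ≤ 1/p²}` with `p ≥ R`. The factor `24` makes the Lyapunov–Perron operator,
whose Lipschitz constant is at most `12 K / R`, contract by `1/2`. -/
structure IsPerronPair (A G : ℂ × ℂ → ℂ) (K R : ℝ) : Prop where
  one_le : 1 ≤ R
  nonneg : 0 ≤ K
  le : 24 * K ≤ R
  diff_fst : ∀ p, R ≤ p → ∀ q ∈ perronRegion p, DifferentiableAt ℂ A q
  diff_snd : ∀ p, R ≤ p → ∀ q ∈ perronRegion p, DifferentiableAt ℂ G q
  norm_fst : ∀ p, R ≤ p → ∀ q ∈ perronRegion p, ‖A q‖ ≤ K / p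
  norm_snd : ∀ p, R ≤ p → ∀ q ∈ perronRegion p, ‖G q‖ ≤ K / p ^ 4
  lipschitz_fst : ∀ p, R ≤ p → ∀ q ∈ perronRegion p, ∀ q' ∈ perronRegion p,
    ‖A q - A q'‖ ≤ K * (‖q.1 - q'.1‖ / p ^ 2 + ‖q.2 - q'.2‖)
  lipschitz_snd : ∀ p, R ≤ p → ∀ q ∈ perronRegion p, ∀ q' ∈ perronRegion p,
    ‖G q - G q'‖ ≤ K * (‖q.1 - q'.1‖ / p ^ 5 + ‖q.2 - q'.2‖ / p ^ 2)

/-- The point `(Zₙ, wₙ)` determined by the initial value `Z₀` and the normalized unknowns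
`u n = (Zₙ₊₁ - Zₙ - 1, (R + n/2)² wₙ)`. -/
noncomputable def perronPoint (R : ℝ) (Z : ℂ) (u : ℕ → ℂ × ℂ) (n : ℕ) : ℂ × ℂ :=
  (Z + n + ∑ k ∈ Finset.range n, (u k).1, (u n).2 / ((R + n / 2) ^ 2 : ℝ))

/-- The Lyapunov–Perron operator. Its fixed points are the orbits along which `w` tends to `0`,
because then `wₙ = ∑_{k ≥ n} G(Z_k, w_k)`. -/
noncomputable def perronOp (A G : ℂ × ℂ → ℂ) (R : ℝ) (Z : ℂ) (u : ℕ → ℂ × ℂ) (n : ℕ) : ℂ × ℂ :=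
  (A (perronPoint R Z u n),
    ((R + n / 2) ^ 2 : ℝ) * ∑' k, G (perronPoint R Z u (n + k)))

/-- The weight of the index `n + k` relative to `R` is the weight of `k` relative to the weight
of `n`. -/
theorem weight_add (R : ℝ) (n k : ℕ) :
    R + ((n + k : ℕ) : ℝ) / 2 = (R + n / 2) + k / 2 := by push_cast; ring

/-- Terms of order `p⁻⁴` have tails of order `p⁻³`: in the normalization by `p²` a factor `1/p` is
gained. -/
theorem tail_bound {p M : ℝ} (hp : 1 ≤ p) (hM : 0 ≤ M) {s : ℕ → ℂ}
    (hs : ∀ k : ℕ, ‖s k‖ ≤ M / (p + k / 2) ^ 4) :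
    Summable s ∧ ‖((p ^ 2 : ℝ) : ℂ) * ∑' k, s k‖ ≤ 4 * M / p := by
  have hs' : ∀ k : ℕ, ‖s k‖ ≤ M / p ^ 2 * (1 / (p + k / 2) ^ 2) := by
    intro k
    refine (hs k).trans ?_
    have hk : (0 : ℝ) ≤ k := k.cast_nonneg
    rw [div_mul_div_comm, mul_one]
    have e : (p + k / 2) ^ 4 = (p + k / 2) ^ 2 * (p + k / 2) ^ 2 := by ring
    rw [e]
    gcongr
    linarith
  have hsum := (summable_inv_sq hp).mul_left (M / p ^ 2)
  refine ⟨.of_norm_bounded hsum hs', ?_⟩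
  rw [norm_mul, Complex.norm_real, Real.norm_of_nonneg (by positivity)]
  calc p ^ 2 * ‖∑' k, s k‖ ≤ p ^ 2 * (M / p ^ 2 * (4 / p)) := by
        gcongr
        refine (tsum_of_norm_bounded hsum.hasSum hs').trans ?_
        rw [tsum_mul_left]
        gcongr
        exact tsum_inv_sq_le hp
    _ = _ := by field_simp

namespace IsPerronPair

variable {A G : ℂ × ℂ → ℂ} {K R : ℝ}

theorem mono (h : IsPerronPair A G K R) {R' : ℝ} (hR : R ≤ R') : IsPerronPair A G K R' where
  one_le := h.one_le.trans hR
  nonneg := h.nonneg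
  le := h.le.trans hR
  diff_fst := fun p hp => h.diff_fst p (hR.trans hp)
  diff_snd := fun p hp => h.diff_snd p (hR.trans hp)
  norm_fst := fun p hp => h.norm_fst p (hR.trans hp)
  norm_snd := fun p hp => h.norm_snd p (hR.trans hp)
  lipschitz_fst := fun p hp => h.lipschitz_fst p (hR.trans hp)
  lipschitz_snd := fun p hp => h.lipschitz_snd p (hR.trans hp)

theorem le_weight (_h : IsPerronPair A G K R) (n : ℕ) : R ≤ R + (n : ℝ) / 2 := by
  have : (0 : ℝ) ≤ n := n.cast_nonneg
  linarith

theorem one_le_weight (h : IsPerronPair A G K R) (n : ℕ) : 1 ≤ R + (n : ℝ) / 2 :=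
  h.one_le.trans (h.le_weight n)

theorem perronPoint_mem (h : IsPerronPair A G K R) {Z : ℂ} (hZ : R ≤ Z.re) {u : ℕ → ℂ × ℂ}
    (hu : ∀ n, ‖u n‖ ≤ 1 / 2) (n : ℕ) : perronPoint R Z u n ∈ perronRegion (R + n / 2) := by
  have hp := h.one_le_weight n
  constructor
  · have h1 : ‖∑ k ∈ Finset.range n, (u k).1‖ ≤ n / 2 := by
      refine (norm_sum_le_of_le _ fun k _ => (norm_fst_le (u k)).trans (hu k)).trans ?_
      rw [Finset.sum_const, Finset.card_range, nsmul_eq_mul]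
      linarith
    have h2 := (abs_le.1 ((Complex.abs_re_le_norm _).trans h1)).1
    simp only [perronPoint, Complex.add_re, Complex.natCast_re]
    linarith
  · simp only [perronPoint]
    rw [norm_div, Complex.norm_real, Real.norm_of_nonneg (by positivity)]
    gcongr
    exact (norm_snd_le (u n)).trans ((hu n).trans (by norm_num))

theorem norm_snd_point_le (h : IsPerronPair A G K R) {Z : ℂ} (hZ : R ≤ Z.re) {u : ℕ → ℂ × ℂ}
    (hu : ∀ n, ‖u n‖ ≤ 1 / 2) (n k : ℕ) :
    ‖G (perronPoint R Z u (n + k))‖ ≤ K / ((R + n / 2) + k / 2) ^ 4 := by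
  rw [← weight_add]
  exact h.norm_snd _ (h.le_weight _) _ (h.perronPoint_mem hZ hu _)

theorem norm_perronOp_le (h : IsPerronPair A G K R) {Z : ℂ} (hZ : R ≤ Z.re) {u : ℕ → ℂ × ℂ}
    (hu : ∀ n, ‖u n‖ ≤ 1 / 2) (n : ℕ) : ‖perronOp A G R Z u n‖ ≤ 1 / 2 := by
  have hp := h.one_le_weight n
  have hR := h.le_weight n
  have hK := h.le
  refine max_le ?_ ?_
  · refine (h.norm_fst _ hR _ (h.perronPoint_mem hZ hu n)).trans ?_
    rw [div_le_div_iff₀ (by linarith) (by norm_num)]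
    linarith [h.nonneg]
  · refine (tail_bound hp h.nonneg (h.norm_snd_point_le hZ hu n)).2.trans ?_
    rw [div_le_div_iff₀ (by linarith) (by norm_num)]
    linarith [h.nonneg]

theorem norm_perronPoint_sub_le (h : IsPerronPair A G K R) (Z : ℂ) {u v : ℕ → ℂ × ℂ} {d : ℝ}
    (hd : ∀ n, ‖u n - v n‖ ≤ d) (n : ℕ) :
    ‖(perronPoint R Z u n).1 - (perronPoint R Z v n).1‖ ≤ 2 * (R + n / 2) * d ∧
      ‖(perronPoint R Z u n).2 - (perronPoint R Z v n).2‖ ≤ d / (R + n / 2) ^ 2 := by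
  have hp := h.one_le_weight n
  have hd0 : 0 ≤ d := (norm_nonneg _).trans (hd 0)
  constructor
  · have e : (perronPoint R Z u n).1 - (perronPoint R Z v n).1 =
        ∑ k ∈ Finset.range n, (u k - v k).1 := by
      simp only [perronPoint, Prod.fst_sub, Finset.sum_sub_distrib]; ring
    rw [e]
    refine (norm_sum_le_of_le _ fun k _ => (norm_fst_le (u k - v k)).trans (hd k)).trans ?_
    rw [Finset.sum_const, Finset.card_range, nsmul_eq_mul]
    gcongr
    linarith [h.one_le]
  · simp only [perronPoint]
    rw [← sub_div, norm_div, Complex.norm_real, Real.norm_of_nonneg (by positivity)]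
    gcongr
    exact (norm_snd_le (u n - v n)).trans (hd n)

/-- The Lyapunov–Perron operator halves distances in the supremum norm. -/
theorem norm_perronOp_sub_le (h : IsPerronPair A G K R) {Z : ℂ} (hZ : R ≤ Z.re)
    {u v : ℕ → ℂ × ℂ} (hu : ∀ n, ‖u n‖ ≤ 1 / 2) (hv : ∀ n, ‖v n‖ ≤ 1 / 2) {d : ℝ}
    (hd : ∀ n, ‖u n - v n‖ ≤ d) (n : ℕ) :
    ‖perronOp A G R Z u n - perronOp A G R Z v n‖ ≤ d / 2 := by
  have hp := h.one_le_weight n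
  have hRp := h.le_weight n
  have hd0 : 0 ≤ d := (norm_nonneg _).trans (hd 0)
  have hK := h.nonneg
  have hKR := h.le
  refine max_le ?_ ?_
  · refine (h.lipschitz_fst _ hRp _ (h.perronPoint_mem hZ hu n) _
      (h.perronPoint_mem hZ hv n)).trans ?_
    obtain ⟨h1, h2⟩ := h.norm_perronPoint_sub_le Z hd n
    set p := R + (n : ℝ) / 2
    calc _ ≤ K * (2 * p * d / p ^ 2 + d / p ^ 2) := by gcongr
      _ ≤ K * (2 * p * d / p ^ 2 + d / p ^ 1) := by gcongr; norm_num
      _ = (3 * K / p) * d := by field_simp; ring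
      _ ≤ (1 / 2) * d := by
          refine mul_le_mul_of_nonneg_right ?_ hd0
          rw [div_le_div_iff₀ (by linarith) (by norm_num)]; linarith
      _ = d / 2 := by ring
  · have hb : ∀ k : ℕ, ‖G (perronPoint R Z u (n + k)) - G (perronPoint R Z v (n + k))‖ ≤
        3 * K * d / ((R + n / 2) + k / 2) ^ 4 := by
      intro k
      rw [← weight_add]
      refine (h.lipschitz_snd _ (h.le_weight _) _ (h.perronPoint_mem hZ hu _) _
        (h.perronPoint_mem hZ hv _)).trans ?_
      obtain ⟨h1, h2⟩ := h.norm_perronPoint_sub_le Z hd (n + k)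
      have hp' := h.one_le_weight (n + k)
      set p' := R + ((n + k : ℕ) : ℝ) / 2
      calc _ ≤ K * (2 * p' * d / p' ^ 5 + d / p' ^ 2 / p' ^ 2) := by gcongr
        _ = _ := by field_simp; ring
    have hsu := (tail_bound hp h.nonneg (h.norm_snd_point_le hZ hu n)).1
    have hsv := (tail_bound hp h.nonneg (h.norm_snd_point_le hZ hv n)).1
    have := (tail_bound hp (by positivity) hb).2
    simp only [perronOp, Prod.snd_sub]
    rw [← mul_sub, ← hsu.tsum_sub hsv]
    refine this.trans ?_
    rw [div_le_div_iff₀ (by linarith) (by norm_num)]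
    nlinarith

theorem eq_of_fixed (h : IsPerronPair A G K R) {Z : ℂ} (hZ : R ≤ Z.re)
    {u v : ℕ → ℂ × ℂ} (hu : ∀ n, ‖u n‖ ≤ 1 / 2) (hv : ∀ n, ‖v n‖ ≤ 1 / 2)
    (hfu : perronOp A G R Z u = u) (hfv : perronOp A G R Z v = v) : u = v := by
  have key : ∀ j : ℕ, ∀ n, ‖u n - v n‖ ≤ (1 / 2) ^ j := by
    intro j
    induction j with
    | zero =>
      intro n
      refine (norm_sub_le _ _).trans ?_
      rw [pow_zero]; linarith [hu n, hv n]
    | succ j ih =>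
      intro n
      have := h.norm_perronOp_sub_le hZ hu hv ih n
      rw [hfu, hfv] at this
      rw [pow_succ]; linarith
  funext n
  have h0 : Filter.Tendsto (fun j : ℕ => (1 / 2 : ℝ) ^ j) Filter.atTop (nhds 0) :=
    tendsto_pow_atTop_nhds_zero_of_lt_one (by norm_num) (by norm_num)
  have := ge_of_tendsto' h0 (fun j => key j n)
  exact sub_eq_zero.1 (norm_le_zero_iff.1 this)

/-- The Picard iterates of the Lyapunov–Perron operator. -/
noncomputable def picard (A G : ℂ × ℂ → ℂ) (R : ℝ) (Z : ℂ) (j : ℕ) : ℕ → ℂ × ℂ :=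
  (perronOp A G R Z)^[j] 0

theorem picard_succ (A G : ℂ × ℂ → ℂ) (R : ℝ) (Z : ℂ) (j : ℕ) :
    picard A G R Z (j + 1) = perronOp A G R Z (picard A G R Z j) :=
  Function.iterate_succ_apply' _ _ _

theorem norm_picard_le (h : IsPerronPair A G K R) {Z : ℂ} (hZ : R ≤ Z.re) (j n : ℕ) :
    ‖picard A G R Z j n‖ ≤ 1 / 2 := by
  induction j generalizing n with
  | zero => simp [picard]
  | succ j ih => rw [picard_succ]; exact h.norm_perronOp_le hZ ih n

theorem dist_picard_le (h : IsPerronPair A G K R) {Z : ℂ} (hZ : R ≤ Z.re) (n j : ℕ) :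
    dist (picard A G R Z j n) (picard A G R Z (j + 1) n) ≤ 1 * (1 / 2) ^ j := by
  rw [dist_comm, dist_eq_norm, one_mul]
  induction j generalizing n with
  | zero =>
    refine (norm_sub_le _ _).trans ?_
    rw [pow_zero]; linarith [h.norm_picard_le hZ 0 n, h.norm_picard_le hZ 1 n]
  | succ j ih =>
    have := h.norm_perronOp_sub_le hZ (h.norm_picard_le hZ (j + 1)) (h.norm_picard_le hZ j) ih n
    rw [← picard_succ, ← picard_succ] at this
    rw [pow_succ]; linarith

/-- The fixed point of the Lyapunov–Perron operator. -/
noncomputable def perronSol (A G : ℂ × ℂ → ℂ) (R : ℝ) (Z : ℂ) (n : ℕ) : ℂ × ℂ :=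
  Filter.limUnder Filter.atTop (fun j => picard A G R Z j n)

theorem tendsto_picard (h : IsPerronPair A G K R) {Z : ℂ} (hZ : R ≤ Z.re) (n : ℕ) :
    Filter.Tendsto (fun j => picard A G R Z j n) Filter.atTop (nhds (perronSol A G R Z n)) :=
  (cauchySeq_of_le_geometric (1 / 2) 1 (by norm_num) (h.dist_picard_le hZ n)).tendsto_limUnder

theorem norm_picard_sub_perronSol_le (h : IsPerronPair A G K R) {Z : ℂ} (hZ : R ≤ Z.re)
    (j n : ℕ) : ‖picard A G R Z j n - perronSol A G R Z n‖ ≤ 2 * (1 / 2) ^ j := by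
  have := dist_le_of_le_geometric_of_tendsto (1 / 2) 1 (by norm_num) (h.dist_picard_le hZ n)
    (h.tendsto_picard hZ n) j
  rw [dist_eq_norm] at this
  refine this.trans (le_of_eq ?_)
  ring

theorem norm_perronSol_le (h : IsPerronPair A G K R) {Z : ℂ} (hZ : R ≤ Z.re) (n : ℕ) :
    ‖perronSol A G R Z n‖ ≤ 1 / 2 :=
  le_of_tendsto' (h.tendsto_picard hZ n).norm fun j => h.norm_picard_le hZ j n

theorem tendsto_geometric_half :
    Filter.Tendsto (fun j : ℕ => 2 * (1 / 2 : ℝ) ^ j) Filter.atTop (nhds 0) := by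
  simpa using (tendsto_pow_atTop_nhds_zero_of_lt_one (r := (1 / 2 : ℝ)) (by norm_num)
    (by norm_num)).const_mul 2

theorem perronOp_perronSol (h : IsPerronPair A G K R) {Z : ℂ} (hZ : R ≤ Z.re) :
    perronOp A G R Z (perronSol A G R Z) = perronSol A G R Z := by
  funext n
  refine tendsto_nhds_unique (f := fun j => picard A G R Z (j + 1) n) ?_
    ((h.tendsto_picard hZ n).comp (Filter.tendsto_add_atTop_nat 1))
  rw [tendsto_iff_norm_sub_tendsto_zero]
  refine squeeze_zero (fun _ => norm_nonneg _) (fun j => ?_) tendsto_geometric_half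
  rw [picard_succ]
  refine (h.norm_perronOp_sub_le hZ (h.norm_picard_le hZ j) (h.norm_perronSol_le hZ)
    (h.norm_picard_sub_perronSol_le hZ j) n).trans ?_
  have : (0 : ℝ) ≤ (1 / 2) ^ j := by positivity
  linarith

theorem differentiableAt_perronPoint {u : ℂ → ℕ → ℂ × ℂ} {Z : ℂ}
    (hu : ∀ n, DifferentiableAt ℂ (fun Z => u Z n) Z) (n : ℕ) :
    DifferentiableAt ℂ (fun Z => perronPoint R Z (u Z) n) Z := by
  refine DifferentiableAt.prodMk ?_ ((hu n).snd.div_const _)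
  exact (differentiableAt_id.add_const _).add
    (DifferentiableAt.fun_sum fun k _ => (hu k).fst)

theorem isOpen_halfPlane (R : ℝ) : IsOpen {Z : ℂ | R < Z.re} :=
  isOpen_lt continuous_const Complex.continuous_re

theorem differentiableOn_perronOp (h : IsPerronPair A G K R) {u : ℂ → ℕ → ℂ × ℂ}
    (hu : ∀ Z : ℂ, R < Z.re → ∀ n, ‖u Z n‖ ≤ 1 / 2)
    (hd : ∀ n, DifferentiableOn ℂ (fun Z => u Z n) {Z | R < Z.re}) (n : ℕ) :
    DifferentiableOn ℂ (fun Z => perronOp A G R Z (u Z) n) {Z | R < Z.re} := by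
  have hpt : ∀ Z : ℂ, R < Z.re → ∀ m : ℕ,
      DifferentiableAt ℂ (fun Z => perronPoint R Z (u Z) m) Z := fun Z hZ m =>
    differentiableAt_perronPoint
      (fun k => (hd k).differentiableAt ((isOpen_halfPlane R).mem_nhds hZ)) m
  have hmem : ∀ Z : ℂ, R < Z.re → ∀ m : ℕ, perronPoint R Z (u Z) m ∈ perronRegion (R + m / 2) :=
    fun Z hZ m => h.perronPoint_mem hZ.le (hu Z hZ) m
  refine DifferentiableOn.prodMk (fun Z hZ => ?_) (DifferentiableOn.const_mul ?_ _)
  · exact (DifferentiableAt.comp Z (h.diff_fst _ (h.le_weight n) _ (hmem Z hZ n))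
      (hpt Z hZ n)).differentiableWithinAt
  · have hp := h.one_le_weight n
    refine Complex.differentiableOn_tsum_of_summable_norm
      (u := fun k : ℕ => K * (1 / ((R + n / 2) + k / 2) ^ 2))
      ((summable_inv_sq hp).mul_left K) (fun k Z hZ => ?_) (isOpen_halfPlane R)
      (fun k Z hZ => ?_)
    · exact (DifferentiableAt.comp Z (h.diff_snd _ (h.le_weight (n + k)) _ (hmem Z hZ _))
        (hpt Z hZ _)).differentiableWithinAt
    · refine (h.norm_snd_point_le (le_of_lt hZ) (hu Z hZ) n k).trans ?_
      rw [mul_one_div]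
      have hk : (0 : ℝ) ≤ k := k.cast_nonneg
      have := h.nonneg
      gcongr
      · linarith
      · norm_num

theorem differentiableOn_picard (h : IsPerronPair A G K R) (j n : ℕ) :
    DifferentiableOn ℂ (fun Z => picard A G R Z j n) {Z | R < Z.re} := by
  induction j generalizing n with
  | zero => exact differentiableOn_const _
  | succ j ih =>
    simp_rw [picard_succ]
    exact h.differentiableOn_perronOp (fun Z hZ => h.norm_picard_le hZ.le j) ih n

theorem differentiableOn_perronSol (h : IsPerronPair A G K R) (n : ℕ) :
    DifferentiableOn ℂ (fun Z => perronSol A G R Z n) {Z | R < Z.re} := by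
  refine TendstoLocallyUniformlyOn.differentiableOn (φ := Filter.atTop)
    (F := fun j Z => picard A G R Z j n) (TendstoUniformlyOn.tendstoLocallyUniformlyOn ?_)
    (Filter.Eventually.of_forall fun j => h.differentiableOn_picard j n) (isOpen_halfPlane R)
  rw [Metric.tendstoUniformlyOn_iff]
  intro e he
  filter_upwards [tendsto_geometric_half.eventually (gt_mem_nhds he)] with j hj Z hZ
  rw [dist_comm, dist_eq_norm]
  exact (h.norm_picard_sub_perronSol_le (le_of_lt hZ) j n).trans_lt hj

/-- Orbits of `(Z, w) ↦ (Z + 1 + A(Z, w), w - G(Z, w))` along which `w` decays quadratically. -/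
structure IsStableOrbit (A G : ℂ × ℂ → ℂ) (R : ℝ) (q : ℕ → ℂ × ℂ) : Prop where
  le_re : R ≤ (q 0).1.re
  step : ∀ n, q (n + 1) = ((q n).1 + 1 + A (q n), (q n).2 - G (q n))
  decay : ∀ n : ℕ, ‖(q n).2‖ ≤ 1 / 2 / (R + n / 2) ^ 2

theorem isStableOrbit_perronPoint (h : IsPerronPair A G K R) {Z : ℂ} (hZ : R ≤ Z.re) :
    IsStableOrbit A G R (perronPoint R Z (perronSol A G R Z)) := by
  have hu := h.norm_perronSol_le hZ
  have hfix := h.perronOp_perronSol hZ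
  set u := perronSol A G R Z with hudef
  refine ⟨by simpa [perronPoint] using hZ, fun n => ?_, fun n => ?_⟩
  · have h1 : (u n).1 = A (perronPoint R Z u n) := by
      conv_lhs => rw [← hfix]
      rfl
    have h2 : ∀ m, (perronPoint R Z u m).2 = ∑' k, G (perronPoint R Z u (m + k)) := by
      intro m
      have hp := h.one_le_weight m
      have : (u m).2 = ((R + m / 2) ^ 2 : ℝ) * ∑' k, G (perronPoint R Z u (m + k)) := by
        conv_lhs => rw [← hfix]
        rfl
      have hne : (((R + m / 2) ^ 2 : ℝ) : ℂ) ≠ 0 := by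
        rw [Complex.ofReal_ne_zero]; positivity
      rw [perronPoint, this, mul_div_cancel_left₀ _ hne]
    refine Prod.ext ?_ ?_
    · change Z + ((n + 1 : ℕ) : ℂ) + ∑ k ∈ Finset.range (n + 1), (u k).1 =
        Z + n + ∑ k ∈ Finset.range n, (u k).1 + 1 + A (perronPoint R Z u n)
      rw [Finset.sum_range_succ, h1]
      push_cast; ring
    · change (perronPoint R Z u (n + 1)).2 = (perronPoint R Z u n).2 - G (perronPoint R Z u n)
      have hs := (tail_bound (h.one_le_weight n) h.nonneg (h.norm_snd_point_le hZ hu n)).1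
      rw [h2 n, h2 (n + 1), hs.tsum_eq_zero_add, add_zero, add_sub_cancel_left]
      refine tsum_congr fun k => ?_
      congr 2; omega
  · have hp := h.one_le_weight n
    simp only [perronPoint]
    rw [norm_div, Complex.norm_real, Real.norm_of_nonneg (by positivity)]
    gcongr
    exact (norm_snd_le (u n)).trans (hu n)

theorem mem_perronRegion_of_isStableOrbit (h : IsPerronPair A G K R) {q : ℕ → ℂ × ℂ}
    (hq : IsStableOrbit A G R q) (n : ℕ) : q n ∈ perronRegion (R + n / 2) := by
  refine ⟨?_, (hq.decay n).trans ?_⟩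
  · induction n with
    | zero => simpa using hq.le_re
    | succ n ih =>
      have hp := h.one_le_weight n
      have hm : q n ∈ perronRegion (R + n / 2) := ⟨ih, (hq.decay n).trans (by gcongr; norm_num)⟩
      have hA : ‖A (q n)‖ ≤ 1 / 2 := by
        refine (h.norm_fst _ (h.le_weight n) _ hm).trans ?_
        rw [div_le_div_iff₀ (by linarith) (by norm_num)]
        linarith [h.le, h.nonneg, h.le_weight n]
      have := (abs_le.1 ((Complex.abs_re_le_norm _).trans hA)).1
      rw [hq.step n]
      simp only [Complex.add_re, Complex.one_re]
      push_cast
      linarith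
  · have hp := h.one_le_weight n
    gcongr; norm_num

/-- A stable orbit is determined by the initial value of `Z`, since its normalized unknowns are
a fixed point of the Lyapunov–Perron operator. -/
theorem eq_perronPoint_of_isStableOrbit (h : IsPerronPair A G K R) {q : ℕ → ℂ × ℂ}
    (hq : IsStableOrbit A G R q) :
    q = perronPoint R (q 0).1 (perronSol A G R (q 0).1) := by
  have hmem := h.mem_perronRegion_of_isStableOrbit hq
  set u : ℕ → ℂ × ℂ := fun n => (A (q n), ((R + n / 2) ^ 2 : ℝ) * (q n).2) with hu
  have hqu : perronPoint R (q 0).1 u = q := by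
    funext n
    refine Prod.ext ?_ ?_
    · simp only [perronPoint, hu]
      induction n with
      | zero => simp
      | succ n ih =>
        rw [Finset.sum_range_succ, hq.step n]
        rw [← ih]
        push_cast; ring
    · have hp := h.one_le_weight n
      have hne : (((R + n / 2) ^ 2 : ℝ) : ℂ) ≠ 0 := by
        rw [Complex.ofReal_ne_zero]; positivity
      simp only [perronPoint, hu]
      rw [mul_div_cancel_left₀ _ hne]
  have hub : ∀ n, ‖u n‖ ≤ 1 / 2 := by
    intro n
    have hp := h.one_le_weight n
    refine max_le ?_ ?_
    · refine (h.norm_fst _ (h.le_weight n) _ (hmem n)).trans ?_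
      rw [div_le_div_iff₀ (by linarith) (by norm_num)]
      linarith [h.le, h.nonneg, h.le_weight n]
    · simp only [hu]
      rw [norm_mul, Complex.norm_real, Real.norm_of_nonneg (by positivity), mul_comm,
        ← le_div_iff₀ (by positivity)]
      exact hq.decay n
  have hfix : perronOp A G R (q 0).1 u = u := by
    funext n
    rw [perronOp]
    simp_rw [hqu]
    refine Prod.ext rfl ?_
    have hp := h.one_le_weight n
    have hs : Summable fun k => G (q (n + k)) := by
      have := (tail_bound hp h.nonneg (h.norm_snd_point_le hq.le_re hub n)).1
      simpa only [hqu] using this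
    have h0 : Filter.Tendsto (fun k : ℕ => (q (n + k)).2) Filter.atTop (nhds 0) := by
      refine squeeze_zero_norm (a := fun k : ℕ => 1 / (2 * (R + n / 2) + k)) (fun k => ?_) ?_
      · refine (hq.decay (n + k)).trans ?_
        have hk : (0 : ℝ) ≤ k := k.cast_nonneg
        rw [weight_add, div_div]
        refine one_div_le_one_div_of_le (by linarith) ?_
        nlinarith
      · refine Filter.Tendsto.div_atTop tendsto_const_nhds ?_
        exact Filter.tendsto_atTop_add_const_left _ _ tendsto_natCast_atTop_atTop
    have hsum : ∑' k, G (q (n + k)) = (q n).2 := by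
      have h1 := (h0.const_sub (q n).2)
      rw [sub_zero] at h1
      refine tendsto_nhds_unique hs.hasSum.tendsto_sum_nat (h1.congr fun m => ?_)
      have : ∀ k, G (q (n + k)) = (q (n + k)).2 - (q (n + (k + 1))).2 := by
        intro k
        rw [← add_assoc, hq.step (n + k), sub_sub_cancel]
      simp_rw [this]
      rw [Finset.sum_range_sub' (fun k => (q (n + k)).2)]
      rfl
    simp only [hu, hsum]
  have := h.eq_of_fixed hq.le_re hub (h.norm_perronSol_le hq.le_re) hfix
    (h.perronOp_perronSol hq.le_re)
  rw [← this, hqu]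

/-- The graph of initial points of stable orbits. -/
noncomputable def stableGraph (A G : ℂ × ℂ → ℂ) (R : ℝ) (Z : ℂ) : ℂ :=
  (perronPoint R Z (perronSol A G R Z) 0).2

theorem perronPoint_zero (A G : ℂ × ℂ → ℂ) (R : ℝ) (Z : ℂ) :
    perronPoint R Z (perronSol A G R Z) 0 = (Z, stableGraph A G R Z) := by
  rw [stableGraph, perronPoint]; simp

theorem differentiableOn_stableGraph (h : IsPerronPair A G K R) :
    DifferentiableOn ℂ (stableGraph A G R) {Z | R < Z.re} :=
  (h.differentiableOn_perronSol 0).snd.div_const _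

theorem snd_eq_stableGraph (h : IsPerronPair A G K R) {q : ℕ → ℂ × ℂ}
    (hq : IsStableOrbit A G R q) : (q 0).2 = stableGraph A G R (q 0).1 := by
  have : q 0 = ((q 0).1, stableGraph A G R (q 0).1) := by
    rw [← perronPoint_zero]
    exact congrFun (h.eq_perronPoint_of_isStableOrbit hq) 0
  exact (Prod.ext_iff.1 this).2

theorem IsStableOrbit.of_le {q : ℕ → ℂ × ℂ} {R' : ℝ} (hR0 : 0 < R) (hR : R ≤ R')
    (hq : IsStableOrbit A G R' q) : IsStableOrbit A G R q := by
  refine ⟨hR.trans hq.le_re, hq.step, fun n => (hq.decay n).trans ?_⟩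
  gcongr

theorem norm_stableGraph_le (h : IsPerronPair A G K R) {Z : ℂ} (hZ : R ≤ Z.re) :
    ‖stableGraph A G R Z‖ ≤ 1 / Z.re ^ 2 := by
  have hR := h.one_le
  -- The solution for the larger parameter `Re Z` obeys better bounds, and coincides with the
  -- one for `R` by uniqueness.
  have h1 := (h.mono hZ).isStableOrbit_perronPoint (le_refl Z.re)
  have h2 := h.snd_eq_stableGraph (h1.of_le (by linarith) hZ)
  have h3 := h1.decay 0
  rw [h2, perronPoint_zero] at h3
  refine h3.trans ?_
  simp only [Nat.cast_zero, zero_div, add_zero]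
  gcongr; norm_num

theorem IsStableOrbit.shift (h : IsPerronPair A G K R) {q : ℕ → ℂ × ℂ}
    (hq : IsStableOrbit A G R q) : IsStableOrbit A G R (fun n => q (n + 1)) := by
  have hR := h.one_le
  refine ⟨?_, fun n => hq.step (n + 1), fun n => (hq.decay (n + 1)).trans ?_⟩
  · exact (h.le_weight 1).trans (h.mem_perronRegion_of_isStableOrbit hq 1).1
  · gcongr
    exact Nat.le_succ n

theorem stableGraph_invariant (h : IsPerronPair A G K R) {Z : ℂ} (hZ : R ≤ Z.re) :
    stableGraph A G R Z - G (Z, stableGraph A G R Z) =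
      stableGraph A G R (Z + 1 + A (Z, stableGraph A G R Z)) := by
  have hq := h.isStableOrbit_perronPoint hZ
  have h1 := h.snd_eq_stableGraph (IsStableOrbit.shift h hq)
  rw [zero_add, hq.step 0, perronPoint_zero] at h1
  exact h1

end IsPerronPair

/-! ### Existence of a parabolic graph -/

/-- The deviation of the first component of `F` from `Z ↦ Z + 1` in the coordinates `(-1/z, w)`. -/
noncomputable def translationError (F : ℂ × ℂ → ℂ × ℂ) (q : ℂ × ℂ) : ℂ :=
  -(F (-q.1⁻¹, q.2)).1⁻¹ - q.1 - 1

/-- The deviation of the second component of `F` from the identity in the coordinates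
`(-1/z, w)`. -/
noncomputable def verticalError (F : ℂ × ℂ → ℂ × ℂ) (q : ℂ × ℂ) : ℂ :=
  q.2 - (F (-q.1⁻¹, q.2)).2

theorem exists_germ_bound {F : ℂ × ℂ ≃ ℂ × ℂ} (hF : IsSpecialAutomorphism F) :
    ∃ c ρ : ℝ, 0 ≤ c ∧ 0 < ρ ∧ ∀ z w : ℂ, ‖z‖ < ρ → ‖w‖ < ρ →
      ‖(F (z, w)).1 - (z + z ^ 2)‖ ≤ c * (‖z‖ ^ 3 + ‖z‖ ^ 2 * ‖w‖) ∧
      ‖(F (z, w)).2 - (w - z * w ^ 2)‖ ≤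
        c * (‖z‖ ^ 4 + ‖z‖ ^ 3 * ‖w‖ + ‖z‖ ^ 2 * ‖w‖ ^ 2 + ‖z‖ * ‖w‖ ^ 3) := by
  obtain ⟨c₁, h₁, hc₁⟩ := hF.germ_fst.exists_nonneg
  obtain ⟨c₂, h₂, hc₂⟩ := hF.germ_snd.exists_nonneg
  obtain ⟨ρ, hρ, hball⟩ := Metric.mem_nhds_iff.1 (hc₁.bound.and hc₂.bound)
  refine ⟨max c₁ c₂, ρ, h₁.trans (le_max_left _ _), hρ, fun z w hz hw => ?_⟩
  have hmem : (z, w) ∈ Metric.ball (0 : ℂ × ℂ) ρ := by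
    rw [mem_ball_zero_iff]
    exact max_lt hz hw
  obtain ⟨b₁, b₂⟩ := hball hmem
  rw [Real.norm_of_nonneg (by positivity)] at b₁ b₂
  constructor
  · refine b₁.trans ?_
    gcongr
    exact le_max_left _ _
  · refine b₂.trans ?_
    gcongr
    exact le_max_right _ _

/-- Bounds on the two errors on the regions `{Re Z ≥ p/2, |w| ≤ 2/p}`. -/
theorem exists_error_bound {F : ℂ × ℂ ≃ ℂ × ℂ} (hF : IsSpecialAutomorphism F) :
    ∃ M R : ℝ, 0 ≤ M ∧ 1 ≤ R ∧ ∀ p, R ≤ p → ∀ Z w : ℂ, p / 2 ≤ Z.re → ‖w‖ ≤ 2 / p →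
      (F (-Z⁻¹, w)).1 ≠ 0 ∧
      DifferentiableAt ℂ (translationError F) (Z, w) ∧
      DifferentiableAt ℂ (verticalError F) (Z, w) ∧
      ‖translationError F (Z, w)‖ ≤ M / p ∧
      (‖w‖ ≤ 2 / p ^ 2 → ‖verticalError F (Z, w)‖ ≤ M / p ^ 4) := by
  obtain ⟨c, ρ, hc, hρ, hb⟩ := exists_germ_bound hF
  refine ⟨64 * c + 8, max 8 (max (4 * c) (4 / ρ)), by positivity, ?_, fun p hp Z w hZ hw => ?_⟩
  · exact le_trans (by norm_num) (le_max_left _ _)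
  obtain ⟨hp8, hpc, hpρ⟩ : 8 ≤ p ∧ 4 * c ≤ p ∧ 4 / ρ ≤ p := by simpa using hp
  have hp0 : 0 < p := by linarith
  have hZre : 0 < Z.re := by linarith
  have hZ0 : Z ≠ 0 := by rintro rfl; simp at hZre
  have hZn : p / 2 ≤ ‖Z‖ := hZ.trans (Complex.re_le_norm Z)
  set z : ℂ := -Z⁻¹ with hz
  have hz0 : z ≠ 0 := neg_ne_zero.2 (inv_ne_zero hZ0)
  have hzn : ‖z‖ ≤ 2 / p := by
    rw [hz, norm_neg, norm_inv, inv_le_comm₀ (by linarith) (by positivity), inv_div]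
    exact hZn
  have h2p : 2 / p < ρ := by
    rw [div_le_iff₀ hρ] at hpρ
    rw [div_lt_iff₀ hp0]; linarith
  have hz4 : ‖z‖ ≤ 1 / 4 := by
    refine hzn.trans ?_
    rw [div_le_div_iff₀ hp0 (by norm_num)]; linarith
  obtain ⟨b₁, b₂⟩ := hb z w (hzn.trans_lt h2p) (hw.trans_lt h2p)
  have hcp : c * (4 / p) ≤ 1 := by
    rw [← mul_div_assoc, div_le_one hp0]; linarith
  obtain ⟨hF0, hA⟩ := neg_inv_add_inv_sub_one (f := (F (z, w)).1) (c := c * (4 / p)) hz0 hz4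
    hcp (by
      refine b₁.trans ?_
      have : ‖z‖ ^ 3 + ‖z‖ ^ 2 * ‖w‖ = (‖z‖ + ‖w‖) * ‖z‖ ^ 2 := by ring
      rw [this, ← mul_assoc]
      gcongr
      have : 4 / p = 2 / p + 2 / p := by ring
      linarith)
  have hd : DifferentiableAt ℂ (fun q : ℂ × ℂ => F (-q.1⁻¹, q.2)) (Z, w) := by
    have h1 : DifferentiableAt ℂ (fun q : ℂ × ℂ => (-q.1⁻¹, q.2)) (Z, w) :=
      (differentiableAt_fst.fun_inv hZ0).neg.prodMk differentiableAt_snd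
    exact DifferentiableAt.comp (Z, w) (hF.holo (z, w)) h1
  refine ⟨hF0, ?_, ?_, ?_, fun hw2 => ?_⟩
  · exact ((hd.fst.fun_inv hF0).neg.sub differentiableAt_fst).sub_const 1
  · exact differentiableAt_snd.sub hd.snd
  · have e : -z⁻¹ = Z := by rw [hz, inv_neg, inv_inv, neg_neg]
    rw [e] at hA
    refine hA.trans ?_
    calc 4 * (c * (4 / p) + ‖z‖) ≤ 4 * (c * (4 / p) + 2 / p) := by gcongr
      _ = (16 * c + 8) / p := by ring
      _ ≤ (64 * c + 8) / p := by gcongr; norm_num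
  · have e : verticalError F (Z, w) = z * w ^ 2 - ((F (z, w)).2 - (w - z * w ^ 2)) := by
      simp only [verticalError, ← hz]; ring
    rw [e]
    have hp1 : 1 ≤ p := by linarith
    calc ‖z * w ^ 2 - ((F (z, w)).2 - (w - z * w ^ 2))‖
        ≤ ‖z‖ * ‖w‖ ^ 2 +
          c * (‖z‖ ^ 4 + ‖z‖ ^ 3 * ‖w‖ + ‖z‖ ^ 2 * ‖w‖ ^ 2 + ‖z‖ * ‖w‖ ^ 3) := by
          refine (norm_sub_le _ _).trans (add_le_add (le_of_eq ?_) b₂)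
          rw [norm_mul, norm_pow]
      _ ≤ 2 / p * (2 / p ^ 2) ^ 2 + c * ((2 / p) ^ 4 + (2 / p) ^ 3 * (2 / p) +
          (2 / p) ^ 2 * (2 / p) ^ 2 + (2 / p) * (2 / p) ^ 3) := by gcongr
      _ = 8 / p ^ 5 + 64 * c / p ^ 4 := by field_simp; ring
      _ ≤ 8 / p ^ 4 + 64 * c / p ^ 4 := by gcongr; norm_num
      _ = _ := by ring

/-- The Lipschitz bounds follow from the sup bounds on the larger regions `{Re Z ≥ p/2, |w| ≤ 2/p}`
and `{Re Z ≥ p/2, |w| ≤ 2/p²}`, one variable at a time. -/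
theorem exists_isPerronPair {F : ℂ × ℂ ≃ ℂ × ℂ} (hF : IsSpecialAutomorphism F) :
    ∃ K R : ℝ, 100 * K ≤ R ∧ IsPerronPair (translationError F) (verticalError F) K R ∧
      ∀ q ∈ perronRegion R, (F (-q.1⁻¹, q.2)).1 ≠ 0 := by
  obtain ⟨M, R₀, hM, hR₀, hb⟩ := exists_error_bound hF
  have hR1 : R₀ ≤ max R₀ (200 * M) := le_max_left _ _
  have hR2 : 200 * M ≤ max R₀ (200 * M) := le_max_right _ _
  -- Points of the region `perronRegion p` lie in the domain of the bounds.
  have hsub : ∀ p, R₀ ≤ p → ∀ q ∈ perronRegion p,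
      p / 2 ≤ q.1.re ∧ ‖q.2‖ ≤ 1 / p ∧ ‖q.2‖ ≤ 1 / p ^ 2 := by
    intro p hp q hq
    refine ⟨by linarith [hq.1], hq.2.trans ?_, hq.2⟩
    have : p ^ 1 ≤ p ^ 2 := pow_le_pow_right₀ (by linarith) (by norm_num)
    rw [pow_one] at this
    exact one_div_le_one_div_of_le (by linarith) this
  have hconv : ∀ p : ℝ, Convex ℝ {Z : ℂ | p ≤ Z.re} := convex_halfSpace_re_ge
  have hball : ∀ p : ℝ, ∀ Z ∈ {Z : ℂ | p ≤ Z.re},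
      Metric.closedBall Z (p / 2) ⊆ {Z : ℂ | p / 2 ≤ Z.re} := by
    intro p Z hZ W hW
    rw [mem_closedBall_iff_norm] at hW
    have h1 := (abs_le.1 ((Complex.abs_re_le_norm (W - Z)).trans hW)).1
    have hZ' : p ≤ Z.re := hZ
    rw [Complex.sub_re] at h1
    change p / 2 ≤ W.re
    linarith
  have hball' : ∀ r : ℝ, ∀ w ∈ Metric.closedBall (0 : ℂ) (1 / r),
      Metric.closedBall w (1 / r) ⊆ Metric.closedBall (0 : ℂ) (2 / r) := by
    intro r w hw
    refine Metric.closedBall_subset_closedBall' ?_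
    have : 2 / r = 1 / r + 1 / r := by ring
    rw [this]
    exact add_le_add_right (Metric.mem_closedBall.1 hw) _
  have h2p : ∀ p : ℝ, R₀ ≤ p → 1 / p ≤ 2 / p ∧ 1 / p ^ 2 ≤ 2 / p ^ 2 ∧ 2 / p ^ 2 ≤ 2 / p := by
    intro p hp
    have hp1 : 1 ≤ p := hR₀.trans hp
    refine ⟨by gcongr; norm_num, by gcongr; norm_num, ?_⟩
    gcongr
    exact le_self_pow₀ hp1 (by norm_num)
  refine ⟨2 * M, max R₀ (200 * M), by linarith, ⟨hR₀.trans hR1, by linarith, by linarith,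
    fun p hp q hq => ?_, fun p hp q hq => ?_, fun p hp q hq => ?_, fun p hp q hq => ?_,
    fun p hp q hq q' hq' => ?_, fun p hp q hq q' hq' => ?_⟩, fun q hq => ?_⟩
  · obtain ⟨h1, h2, -⟩ := hsub p (hR1.trans hp) q hq
    exact (hb p (hR1.trans hp) q.1 q.2 h1 (h2.trans (h2p p (hR1.trans hp)).1)).2.1
  · obtain ⟨h1, h2, -⟩ := hsub p (hR1.trans hp) q hq
    exact (hb p (hR1.trans hp) q.1 q.2 h1 (h2.trans (h2p p (hR1.trans hp)).1)).2.2.1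
  · obtain ⟨h1, h2, -⟩ := hsub p (hR1.trans hp) q hq
    have hp1 : 1 ≤ p := hR₀.trans (hR1.trans hp)
    refine (hb p (hR1.trans hp) q.1 q.2 h1 (h2.trans (h2p p (hR1.trans hp)).1)).2.2.2.1.trans ?_
    gcongr
    linarith
  · obtain ⟨h1, h2, h3⟩ := hsub p (hR1.trans hp) q hq
    have hp1 : 1 ≤ p := hR₀.trans (hR1.trans hp)
    refine ((hb p (hR1.trans hp) q.1 q.2 h1 (h2.trans (h2p p (hR1.trans hp)).1)).2.2.2.2
      (h3.trans (h2p p (hR1.trans hp)).2.1)).trans ?_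
    gcongr
    linarith
  · have hpR : R₀ ≤ p := hR1.trans hp
    have hp1 : 1 ≤ p := hR₀.trans hpR
    obtain ⟨h1, h2, -⟩ := hsub p hpR q hq
    obtain ⟨h1', h2', -⟩ := hsub p hpR q' hq'
    have hZ := norm_sub_le_of_differentiableOn (f := fun Z => translationError F (Z, q.2))
      (U := {Z : ℂ | p / 2 ≤ Z.re}) (S := {Z : ℂ | p ≤ Z.re}) (M := M / p) (r := p / 2)
      (by linarith)
      (fun Z hZ => DifferentiableAt.comp Z (g := translationError F)
        (hb p hpR Z q.2 hZ (h2.trans (h2p p hpR).1)).2.1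
        (differentiableAt_id.prodMk (differentiableAt_const _)))
      (fun Z hZ => (hb p hpR Z q.2 hZ (h2.trans (h2p p hpR).1)).2.2.2.1)
      (hconv p) (hball p) (x := q.1) (y := q'.1) hq.1 hq'.1
    have hw := norm_sub_le_of_differentiableOn (f := fun w => translationError F (q'.1, w))
      (U := Metric.closedBall 0 (2 / p)) (S := Metric.closedBall 0 (1 / p)) (M := M / p)
      (r := 1 / p) (by positivity)
      (fun w hw => DifferentiableAt.comp w (g := translationError F)
        (hb p hpR q'.1 w h1' (mem_closedBall_zero_iff.1 hw)).2.1
        ((differentiableAt_const _).prodMk differentiableAt_id))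
      (fun w hw => (hb p hpR q'.1 w h1' (mem_closedBall_zero_iff.1 hw)).2.2.2.1)
      (convex_closedBall _ _) (hball' p) (x := q.2) (y := q'.2)
      (mem_closedBall_zero_iff.2 h2) (mem_closedBall_zero_iff.2 h2')
    calc ‖translationError F q - translationError F q'‖
        ≤ M / p / (p / 2) * ‖q.1 - q'.1‖ + M / p / (1 / p) * ‖q.2 - q'.2‖ :=
          (norm_sub_le_norm_sub_add_norm_sub _ (translationError F (q'.1, q.2)) _).trans
            (add_le_add hZ hw)
      _ = 2 * M * (‖q.1 - q'.1‖ / p ^ 2) + M * ‖q.2 - q'.2‖ := by field_simp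
      _ ≤ 2 * M * (‖q.1 - q'.1‖ / p ^ 2) + 2 * M * ‖q.2 - q'.2‖ := by gcongr; linarith
      _ = _ := by ring
  · have hpR : R₀ ≤ p := hR1.trans hp
    have hp1 : 1 ≤ p := hR₀.trans hpR
    obtain ⟨h1, h2, h3⟩ := hsub p hpR q hq
    obtain ⟨h1', h2', h3'⟩ := hsub p hpR q' hq'
    have hZ := norm_sub_le_of_differentiableOn (f := fun Z => verticalError F (Z, q.2))
      (U := {Z : ℂ | p / 2 ≤ Z.re}) (S := {Z : ℂ | p ≤ Z.re}) (M := M / p ^ 4) (r := p / 2)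
      (by linarith)
      (fun Z hZ => DifferentiableAt.comp Z (g := verticalError F)
        (hb p hpR Z q.2 hZ (h2.trans (h2p p hpR).1)).2.2.1
        (differentiableAt_id.prodMk (differentiableAt_const _)))
      (fun Z hZ => (hb p hpR Z q.2 hZ (h2.trans (h2p p hpR).1)).2.2.2.2
        (h3.trans (h2p p hpR).2.1))
      (hconv p) (hball p) (x := q.1) (y := q'.1) hq.1 hq'.1
    have hw := norm_sub_le_of_differentiableOn (f := fun w => verticalError F (q'.1, w))
      (U := Metric.closedBall 0 (2 / p ^ 2)) (S := Metric.closedBall 0 (1 / p ^ 2))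
      (M := M / p ^ 4) (r := 1 / p ^ 2) (by positivity)
      (fun w hw => DifferentiableAt.comp w (g := verticalError F)
        (hb p hpR q'.1 w h1' ((mem_closedBall_zero_iff.1 hw).trans (h2p p hpR).2.2)).2.2.1
        ((differentiableAt_const _).prodMk differentiableAt_id))
      (fun w hw => (hb p hpR q'.1 w h1'
        ((mem_closedBall_zero_iff.1 hw).trans (h2p p hpR).2.2)).2.2.2.2
        (mem_closedBall_zero_iff.1 hw))
      (convex_closedBall _ _) (hball' (p ^ 2)) (x := q.2) (y := q'.2)
      (mem_closedBall_zero_iff.2 h3) (mem_closedBall_zero_iff.2 h3')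
    calc ‖verticalError F q - verticalError F q'‖
        ≤ M / p ^ 4 / (p / 2) * ‖q.1 - q'.1‖ + M / p ^ 4 / (1 / p ^ 2) * ‖q.2 - q'.2‖ :=
          (norm_sub_le_norm_sub_add_norm_sub _ (verticalError F (q'.1, q.2)) _).trans
            (add_le_add hZ hw)
      _ = 2 * M * (‖q.1 - q'.1‖ / p ^ 5) + M * (‖q.2 - q'.2‖ / p ^ 2) := by field_simp
      _ ≤ 2 * M * (‖q.1 - q'.1‖ / p ^ 5) + 2 * M * (‖q.2 - q'.2‖ / p ^ 2) := by
          gcongr; linarith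
      _ = _ := by ring
  · obtain ⟨h1, h2, -⟩ := hsub _ hR1 q hq
    exact (hb _ hR1 q.1 q.2 h1 (h2.trans (h2p _ hR1).1)).1

open Classical in
/-- The parabolic graph in the coordinate `z`. -/
noncomputable def parabolicGraph (F : ℂ × ℂ → ℂ × ℂ) (R : ℝ) (z : ℂ) : ℂ :=
  if z = 0 then 0 else
    IsPerronPair.stableGraph (translationError F) (verticalError F) R (-z⁻¹)

theorem closure_sector_subset (ε : ℝ) :
    closure (sector ε) ⊆ {z : ℂ | ‖z‖ ≤ ε ∧ Real.cos (Real.pi / 8) * ‖z‖ ≤ -z.re} := by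
  have h1 : IsClosed {z : ℂ | ‖z‖ ≤ ε} := isClosed_le (by fun_prop) (by fun_prop)
  have h2 : IsClosed {z : ℂ | Real.cos (Real.pi / 8) * ‖z‖ ≤ -z.re} :=
    isClosed_le (by fun_prop) (by fun_prop)
  refine closure_minimal (fun z hz => ?_) (h1.inter h2)
  obtain ⟨-, h3, h4⟩ := mem_sector_iff.1 hz
  exact ⟨h3.le, h4.le⟩

theorem le_re_neg_inv {z : ℂ} (hz0 : z ≠ 0) (hz : Real.cos (Real.pi / 8) * ‖z‖ ≤ -z.re) :
    0.92 / ‖z‖ ≤ (-z⁻¹).re := by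
  have hn : 0 < ‖z‖ := norm_pos_iff.2 hz0
  rw [Complex.neg_re, Complex.inv_re, Complex.normSq_eq_norm_sq, ← neg_div,
    div_le_div_iff₀ hn (by positivity)]
  have := cos_pi_div_eight_bounds.1
  nlinarith [mul_le_mul_of_nonneg_right this.le hn.le]

/-- Translations by numbers close to `1` map the cone `|arg Z| < π/8` into itself and increase
the modulus on it. -/
theorem cone_add_mem {Z v : ℂ} (hZ : Real.cos (Real.pi / 8) * ‖Z‖ < Z.re)
    (hv : ‖v - 1‖ ≤ 1 / 100) :
    ‖Z‖ ≤ ‖Z + v‖ ∧ Real.cos (Real.pi / 8) * ‖Z + v‖ < (Z + v).re := by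
  obtain ⟨hc1, hc2⟩ := cos_pi_div_eight_bounds
  have h1 := abs_le.1 ((Complex.abs_re_le_norm _).trans hv)
  have h2 := abs_le.1 ((Complex.abs_im_le_norm _).trans hv)
  rw [Complex.sub_re, Complex.one_re] at h1
  rw [Complex.sub_im, Complex.one_im, sub_zero] at h2
  have hvn : ‖v‖ ≤ 1.01 := by
    calc ‖v‖ = ‖(v - 1) + 1‖ := by ring_nf
      _ ≤ 1 / 100 + 1 := (norm_add_le _ _).trans (by rw [norm_one]; gcongr)
      _ = 1.01 := by norm_num
  have hZ0 := norm_nonneg Z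
  have hZre : 0.92 * ‖Z‖ ≤ Z.re := by nlinarith
  have hZim := abs_le.1 (Complex.abs_im_le_norm Z)
  constructor
  · rw [← sq_le_sq₀ hZ0 (norm_nonneg _), ← Complex.normSq_eq_norm_sq, ← Complex.normSq_eq_norm_sq,
      Complex.normSq_apply, Complex.normSq_apply, Complex.add_re, Complex.add_im]
    have hprod : 0 ≤ Z.re * v.re + Z.im * v.im := by
      have h3 : Z.re * (99 / 100) ≤ Z.re * v.re := by
        apply mul_le_mul_of_nonneg_left <;> nlinarith
      have h4 : |Z.im * v.im| ≤ ‖Z‖ * (1 / 100) := by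
        rw [abs_mul]
        exact mul_le_mul (abs_le.2 hZim) (abs_le.2 h2) (abs_nonneg _) hZ0
      have h5 := (abs_le.1 h4).1
      norm_num at hZre
      linarith
    nlinarith [sq_nonneg v.re, sq_nonneg v.im]
  · rw [Complex.add_re]
    have h3 : Real.cos (Real.pi / 8) * ‖Z + v‖ ≤ Real.cos (Real.pi / 8) * (‖Z‖ + ‖v‖) := by
      gcongr
      exact norm_add_le _ _
    generalize Real.cos (Real.pi / 8) = κ at *
    norm_num at hc1 hc2 hvn
    nlinarith [norm_nonneg v]

theorem exists_isParabolicGraph {F : ℂ × ℂ ≃ ℂ × ℂ} (hF : IsSpecialAutomorphism F) :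
    ∃ ε : ℝ, 0 < ε ∧ ∃ γ : ℂ → ℂ, IsParabolicGraph F ε γ := by
  obtain ⟨K, R, hKR, h, hne⟩ := exists_isPerronPair hF
  have hR := h.one_le
  have hR0 : 0 < R := by linarith
  have hε : 0 < 1 / (2 * R) := by positivity
  set ε : ℝ := 1 / (2 * R) with hεdef
  set γ := parabolicGraph F R with hγ
  set s := IsPerronPair.stableGraph (translationError F) (verticalError F) R with hs
  have hγ0 : γ 0 = 0 := by simp [hγ, parabolicGraph]
  have hγs : ∀ z : ℂ, z ≠ 0 → γ z = s (-z⁻¹) := fun z hz => by simp [hγ, parabolicGraph, hz, hs]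
  -- On the closed sector the coordinate `-1/z` lies in the half plane `Re Z > R`.
  have hre : ∀ z : ℂ, z ≠ 0 → ‖z‖ ≤ ε → Real.cos (Real.pi / 8) * ‖z‖ ≤ -z.re →
      R < (-z⁻¹).re := by
    intro z hz0 hz1 hz2
    have hn : 0 < ‖z‖ := norm_pos_iff.2 hz0
    refine lt_of_lt_of_le ?_ (le_re_neg_inv hz0 hz2)
    rw [hεdef, le_div_iff₀ (by positivity)] at hz1
    rw [lt_div_iff₀ hn]
    norm_num
    linarith
  have hbound : ∀ z : ℂ, ‖z‖ ≤ ε → Real.cos (Real.pi / 8) * ‖z‖ ≤ -z.re →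
      ‖γ z‖ ≤ 2 * ‖z‖ ^ 2 := by
    intro z hz1 hz2
    by_cases hz0 : z = 0
    · simp [hz0, hγ0]
    have hn : 0 < ‖z‖ := norm_pos_iff.2 hz0
    rw [hγs z hz0]
    refine (h.norm_stableGraph_le (hre z hz0 hz1 hz2).le).trans ?_
    calc 1 / (-z⁻¹).re ^ 2 ≤ 1 / (0.92 / ‖z‖) ^ 2 := by
          gcongr
          exact le_re_neg_inv hz0 hz2
      _ ≤ 2 * ‖z‖ ^ 2 := by
          rw [div_pow, one_div_div, div_le_iff₀ (by norm_num)]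
          norm_num
          nlinarith [sq_nonneg ‖z‖]
  have hdiff : ∀ z : ℂ, z ≠ 0 → ‖z‖ ≤ ε → Real.cos (Real.pi / 8) * ‖z‖ ≤ -z.re →
      DifferentiableAt ℂ γ z := by
    intro z hz0 hz1 hz2
    have h1 : DifferentiableAt ℂ s (-z⁻¹) := h.differentiableOn_stableGraph.differentiableAt
      ((IsPerronPair.isOpen_halfPlane R).mem_nhds (hre z hz0 hz1 hz2))
    have h2 : DifferentiableAt ℂ (fun z => s (-z⁻¹)) z :=
      DifferentiableAt.comp z (g := s) h1 (differentiableAt_inv hz0).fun_neg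
    refine h2.congr_of_eventuallyEq ?_
    filter_upwards [isOpen_ne.mem_nhds hz0] with w hw using hγs w hw
  -- One step of the dynamics on the graph.
  have hstep : ∀ z ∈ sector ε, (F (z, γ z)).1 ∈ sector ε ∧
      (F (z, γ z)).2 = γ (F (z, γ z)).1 ∧
      (-z⁻¹).re + 1 / 2 ≤ (-(F (z, γ z)).1⁻¹).re := by
    intro z hz
    obtain ⟨hn, hz1, hz2⟩ := mem_sector_iff.1 hz
    have hz0 : z ≠ 0 := norm_pos_iff.1 hn
    have hZre := hre z hz0 hz1.le hz2.le
    set Z : ℂ := -z⁻¹ with hZ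
    have hzZ : z = -Z⁻¹ := by rw [hZ, inv_neg, inv_inv, neg_neg]
    have hmem : (Z, s Z) ∈ perronRegion R := by
      refine ⟨hZre.le, (h.norm_stableGraph_le hZre.le).trans ?_⟩
      gcongr
    have hA : ‖translationError F (Z, s Z)‖ ≤ 1 / 100 := by
      refine (h.norm_fst R le_rfl _ hmem).trans ?_
      rw [div_le_div_iff₀ hR0 (by norm_num)]; linarith
    have hγz : γ z = s Z := hγs z hz0
    have hFne : (F (z, γ z)).1 ≠ 0 := by
      rw [hγz, hzZ]; exact hne _ hmem
    have hZ1 : Z + 1 + translationError F (Z, s Z) = -(F (z, γ z)).1⁻¹ := by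
      simp only [translationError, ← hzZ, hγz]; ring
    have hw1 : s Z - verticalError F (Z, s Z) = (F (z, γ z)).2 := by
      simp only [verticalError, ← hzZ, hγz]; ring
    have hinv := h.stableGraph_invariant hZre.le
    rw [← hs, hw1, hZ1, ← hγs _ hFne] at hinv
    refine ⟨?_, hinv, ?_⟩
    · rw [hzZ, neg_inv_mem_sector_iff hε] at hz
      obtain ⟨k0, k1, k2⟩ := hz
      obtain ⟨m1, m2⟩ := cone_add_mem (v := 1 + translationError F (Z, s Z)) k2
        (by rwa [add_sub_cancel_left])
      rw [← add_assoc, hZ1] at m1 m2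
      have := (neg_inv_mem_sector_iff hε).2 ⟨k0.trans_le m1, k1.trans_le m1, m2⟩
      rwa [inv_neg, inv_inv, neg_neg] at this
    · rw [← hZ1, Complex.add_re, Complex.add_re, Complex.one_re]
      linarith [(abs_le.1 ((Complex.abs_re_le_norm _).trans hA)).1]
  have hmaps : Set.MapsTo F (graphCurve ε γ) (graphCurve ε γ) := by
    rintro _ ⟨z, hz, rfl⟩
    obtain ⟨h1, h2, -⟩ := hstep z hz
    exact mem_graphCurve_iff.2 ⟨h1, Prod.ext rfl h2⟩
  refine ⟨ε, hε, γ, fun z hz => ?_, fun z hz => ?_, hγ0, ?_, hmaps, fun p hp => ?_⟩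
  · obtain ⟨hn, hz1, hz2⟩ := mem_sector_iff.1 hz
    exact (hdiff z (norm_pos_iff.1 hn) hz1.le hz2.le).differentiableWithinAt
  · by_cases hz0 : z = 0
    · subst hz0
      rw [ContinuousWithinAt, hγ0]
      refine squeeze_zero_norm' (a := fun z : ℂ => 2 * ‖z‖ ^ 2) ?_ ?_
      · filter_upwards [self_mem_nhdsWithin] with w hw
        obtain ⟨hw1, hw2⟩ := closure_sector_subset ε hw
        exact hbound w hw1 hw2
      · refine tendsto_nhdsWithin_of_tendsto_nhds ?_
        have : Continuous fun z : ℂ => 2 * ‖z‖ ^ 2 := by fun_prop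
        simpa using this.tendsto 0
    · obtain ⟨hz1, hz2⟩ := closure_sector_subset ε hz
      exact (hdiff z hz0 hz1 hz2).continuousAt.continuousWithinAt
  · refine squeeze_zero_norm' (a := fun z : ℂ => 2 * ‖z‖) ?_ ?_
    · filter_upwards [self_mem_nhdsWithin] with z hz
      obtain ⟨hn, hz1, hz2⟩ := mem_sector_iff.1 hz
      rw [norm_div, div_le_iff₀ hn]
      exact (hbound z hz1.le hz2.le).trans (le_of_eq (by ring))
    · refine tendsto_nhdsWithin_of_tendsto_nhds ?_
      have : Continuous fun z : ℂ => 2 * ‖z‖ := by fun_prop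
      simpa using this.tendsto 0
  · have hit : ∀ n : ℕ, F^[n] p ∈ graphCurve ε γ := fun n => hmaps.iterate n hp
    have hgrow : ∀ n : ℕ, R + n / 2 ≤ (-(F^[n] p).1⁻¹).re := by
      intro n
      induction n with
      | zero =>
        obtain ⟨hn, hz1, hz2⟩ := mem_sector_iff.1 (mem_graphCurve_iff.1 hp).1
        simpa using (hre _ (norm_pos_iff.1 hn) hz1.le hz2.le).le
      | succ n ih =>
        obtain ⟨h1, h2⟩ := mem_graphCurve_iff.1 (hit n)
        have := (hstep _ h1).2.2
        rw [← h2] at this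
        rw [Function.iterate_succ_apply']
        push_cast
        linarith
    have hz : ∀ n : ℕ, ‖(F^[n] p).1‖ ≤ 1 / (R + n / 2) := by
      intro n
      have hn : (0 : ℝ) ≤ n := n.cast_nonneg
      have h1 := (hgrow n).trans (Complex.re_le_norm _)
      rw [norm_neg, norm_inv] at h1
      have h2 := inv_anti₀ (by linarith) h1
      rwa [inv_inv, ← one_div] at h2
    have ht : Filter.Tendsto (fun n : ℕ => 1 / (R + (n : ℝ) / 2)) Filter.atTop (nhds 0) :=
      Filter.Tendsto.div_atTop tendsto_const_nhds (Filter.tendsto_atTop_add_const_left _ _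
        (tendsto_natCast_atTop_atTop.atTop_div_const (by norm_num)))
    have hz0 : Filter.Tendsto (fun n : ℕ => (F^[n] p).1) Filter.atTop (nhds 0) :=
      squeeze_zero_norm hz ht
    have hw0 : Filter.Tendsto (fun n : ℕ => (F^[n] p).2) Filter.atTop (nhds 0) := by
      refine squeeze_zero_norm (a := fun n : ℕ => 2 * ‖(F^[n] p).1‖ ^ 2) (fun n => ?_) ?_
      · obtain ⟨h1, h2⟩ := mem_graphCurve_iff.1 (hit n)
        obtain ⟨-, hz1, hz2⟩ := mem_sector_iff.1 h1
        have h3 : (F^[n] p).2 = γ (F^[n] p).1 := congrArg Prod.snd h2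
        rw [h3]
        exact hbound _ hz1.le hz2.le
      · simpa using (hz0.norm.pow 2).const_mul 2
    exact hz0.prodMk_nhds hw0

theorem mainTheorem5 (F : ℂ × ℂ ≃ ℂ × ℂ) (hF : IsSpecialAutomorphism F) :
    (∃ ε : ℝ, 0 < ε ∧ ∃ γ : ℂ → ℂ, IsParabolicGraph F ε γ) ∧
    ∀ (ε : ℝ) (γ : ℂ → ℂ), 0 < ε → IsParabolicGraph F ε γ →
      F '' globalCurve F ε γ = globalCurve F ε γ ∧
      (fun z : ℂ => curveMap F γ z - (z + z ^ 2))
        =O[nhdsWithin 0 (sector ε)] (fun z : ℂ => z ^ 3) ∧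
      ∃ ζ : ℂ → ℂ, IsFatouCoordinate (curveMap F γ) (sector ε) ζ ∧
        ∃ (Φ : ℂ × ℂ → ℂ) (ψ : ℂ → ℂ × ℂ),
          (∀ (p : ℂ × ℂ) (N : ℕ), F^[N] p ∈ graphCurve ε γ →
            Φ p = ζ (F^[N] p).1 - N) ∧
          IsBiholomorphismOntoPlane F ε γ Φ ψ := by
  refine ⟨exists_isParabolicGraph hF, fun ε γ hε hγ => ?_⟩
  obtain ⟨C, R, hR, hg⟩ := exists_isNearTranslation hF hε hγ
  obtain ⟨ψ, hψ⟩ := exists_isBiholomorphismOntoPlane hF hγ hg hε hR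
  exact ⟨image_globalCurve hγ, curveMap_isBigO hF hγ, sectorFatou F ε γ R,
    isFatouCoordinate_sectorFatou hF hγ hg, globalFatou F ε γ R, ψ,
    fun _ _ hp => globalFatou_eq_sectorFatou hF hγ hg hp, hψ⟩
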